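/- Let $(\mathcal V,\otimes,I,c)$ be a braided monoidal category which has equalizers of coreflexive pairs, such that every functor $X\otimes -$ preserves equalizers of coreflexive pairs. Let $\mathrm{Comod}\,\mathcal V$ be the following bicategory. Its objects are the comonoids in $\mathcal V$. Its 1-cells $C\to D$ are the comodules from $C$ to $D$, i.e. objects $M$ with a left $C$-coaction and a right $D$-coaction that commute (equivalently, a coaction $M\to C\otimes M\otimes D$ that is a coalgebra structure for the comonad $C\otimes-\otimes D$). Its 2-cells are the maps that respect the coactions. The composite of $M:E\to C$ and $N:C\to F$ is $M\otimes_C N$, the equalizer of the two maps $M\otimes N\rightrightarrows M\otimes C\otimes N$ given by the right coaction of $C$ on $M$ and the left coaction of $C$ on $N$. The identity of $C$ is $C$, with its comultiplication as coactions. For a bicategory $\mathcal B$ let $\mathrm{Comnd}\,\mathcal B$ be the bicategory of comonads $(B,g)$ in $\mathcal B$. Its 1-cells $(B,g)\to(A,g')$ are the comonad maps $(k:B\to A,\ \kappa:kg\Rightarrow g'k)$, with $\kappa$ compatible with counits and comultiplications, and its 2-cells $(k,\kappa)\Rightarrow(k',\kappa')$ are the 2-cells $\tau:k\Rightarrow k'$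 with $\kappa'\cdot\tau g=g'\tau\cdot\kappa$. Then: 1. $\mathrm{Comod}\,\mathcal V$ admits the Eilenberg–Moore construction for comonads: the inclusion $\mathrm{Comod}\,\mathcal V\to\mathrm{Comnd}(\mathrm{Comod}\,\mathcal V)$, $B\mapsto(B,1)$, has a right biadjoint. 2. Let $E$ be a comonoid. If $G$ is a comonad on $E$ in $\mathrm{Comod}\,\mathcal V$ with comultiplication $\delta:G\to G\otimes_E G$ and counit $\epsilon:G\to E$, then $G$ is a comonoid in $\mathcal V$ with comultiplication $G\xrightarrow{\delta}G\otimes_E G\hookrightarrow G\otimes G$ and counit $G\xrightarrow{\epsilon}E\to I$, and $\epsilon:G\to E$ is a comonoid map. This assignment is an equivalence from the category of comonads on $E$ (with comonoid morphisms in the monoidal category of endo-1-cells of $E$ as morphisms) to the category of comonoid maps with codomain $E$ (the slice category over $E$). Conversely, for a comonoid map $f:G\to E$ let $f_*:G\to E$ be the comodule with underlying object $G$, left coaction $\delta_G$ and right coaction $(1\otimes f)\delta_G$, and let $f^*:E\to G$ be the comodule with underlying object $G$, left coaction $(f\otimes 1)\delta_G$ and right coaction $\delta_G$. Then there is an adjunction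 $f_*\dashv f^*$ whose unit $G\to f_*\otimes_E f^*\hookrightarrow G\otimes G$ is the comultiplication of $G$ and whose counit is $f^*\otimes_G f_*\cong G\xrightarrow{f}E$, and the comonad on $E$ induced by this adjunction is sent by the above assignment to a comonoid map isomorphic, over $E$, to $f$. 3. For every comonad $G$ on a comonoid $E$, the comonoid $G$ is an Eilenberg–Moore object of $(E,G)$, with universal coalgebra $(\epsilon_*,\delta)$: for every comonoid $X$, composition with the coalgebra $\epsilon_*:G\to E$, $\delta:\epsilon_*\Rightarrow \epsilon_*\otimes_E G$, is an equivalence of categories from $\mathrm{Comod}\,\mathcal V(X,G)$ to the category $\mathrm{Comnd}(\mathrm{Comod}\,\mathcal V)((X,1),(E,G))$ of $G$-coalgebras with domain $X$. -/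

import Mathlib

universe v u

set_option linter.unusedSectionVars false

namespace CategoryTheory

namespace Bicategory

universe w₁ w₂ v₁ v₂ u₁ u₂

/-- For `F : B ⥤ᵖ C` and a 1-cell `k : F b ⟶ c`, the functor
`B(x, b) ⥤ C(F x, c)` sending `f` to `F f ≫ k`. -/
def postcompAfter {B : Type u₁} [Bicategory.{w₁, v₁} B] {C : Type u₂} [Bicategory.{w₂, v₂} C]
    (F : B ⥤ᵖ C) (x : B) {b : B} {c : C} (k : F.obj b ⟶ c) : (x ⟶ b) ⥤ (F.obj x ⟶ c) :=
  F.mapFunctor x b ⋙ postcomp (F.obj x) k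

/-- A right biadjoint of a pseudofunctor `F : B ⥤ᵖ C`: a pseudofunctor `G : C ⥤ᵖ B` with a
pseudonatural transformation `ε` from `G` followed by `F` to the identity for which all the
functors `B(x, G c) ⥤ C(F x, c)`, `f ↦ F f ≫ ε_c`, are equivalences. These are the equivalences
`B(x, G c) ≃ C(F x, c)`, pseudonatural in `x` and `c`, of a biadjunction. -/
structure RightBiadjoint {B : Type u₁} [Bicategory.{w₁, v₁} B] {C : Type u₂}
    [Bicategory.{w₂, v₂} C] (F : B ⥤ᵖ C) where
  /-- The right biadjoint pseudofunctor. -/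
  right : C ⥤ᵖ B
  /-- The counit of the biadjunction. -/
  counit : Pseudofunctor.StrongTrans (right.comp F) (Pseudofunctor.id C)
  isEquivalence (x : B) (c : C) : (postcompAfter F x (counit.app c)).IsEquivalence

section

variable {B : Type u₁} [Bicategory.{w₁, v₁} B]

open OplaxTrans OplaxTrans.ComonadBicat

/-- A 1-cell between comonads: a 1-cell `k` with a 2-cell `κ : s ≫ k ⟶ k ≫ t` compatible
with counits and comultiplications. -/
def comonadMap {a b : B} {s : a ⟶ a} {t : b ⟶ b} [Comonad s] [Comonad t] (k : a ⟶ b)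
    (κ : s ≫ k ⟶ k ≫ t)
    (h_counit : κ ≫ k ◁ Comonad.counit = Comonad.counit ▷ k ≫ (λ_ k).hom ≫ (ρ_ k).inv)
    (h_comul : κ ≫ k ◁ Comonad.comul = Comonad.comul ▷ k ≫ (α_ s s k).hom ≫ s ◁ κ ≫
      (α_ s k t).inv ≫ κ ▷ t ≫ (α_ k t t).hom) :
    mkOfComonad s ⟶ mkOfComonad t :=
  show Oplax.OplaxTrans (Comonad.toOplax s) (Comonad.toOplax t) from
  { app := fun _ => k
    naturality := fun _ => κ
    naturality_naturality := fun {_ _ _ _} η => by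
      change 𝟙 s ▷ k ≫ κ = κ ≫ k ◁ 𝟙 t
      simp
    naturality_id := fun _ => h_counit
    naturality_comp := fun _ _ => h_comul }

/-- The 2-cells between comonad maps: 2-cells that commute with the structure. -/
def comonadMap₂ {a b : B} {s : a ⟶ a} {t : b ⟶ b} [Comonad s] [Comonad t]
    {k l : mkOfComonad s ⟶ mkOfComonad t}
    (τ : Oplax.OplaxTrans.app k ⟨⟨⟨⟩⟩⟩ ⟶ Oplax.OplaxTrans.app l ⟨⟨⟨⟩⟩⟩)
    (h : s ◁ τ ≫ Oplax.OplaxTrans.naturality l (𝟙 ⟨⟨⟨⟩⟩⟩) =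
      Oplax.OplaxTrans.naturality k (𝟙 ⟨⟨⟨⟩⟩⟩) ≫ τ ▷ t) : k ⟶ l :=
  ⟨{ app := fun _ => τ
     naturality := fun _ => h }⟩

/-- The inclusion of `B` in the bicategory of comonads in `B`, on 1-cells. -/
def inclusionMap {a b : B} (f : a ⟶ b) : mkOfComonad (𝟙 a) ⟶ mkOfComonad (𝟙 b) :=
  comonadMap f ((λ_ f).hom ≫ (ρ_ f).inv)
    (by
      change _ ≫ f ◁ 𝟙 _ = 𝟙 _ ▷ f ≫ _
      simp)
    (by
      change _ ≫ f ◁ (λ_ (𝟙 b)).inv = (λ_ (𝟙 a)).inv ▷ f ≫ _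
      bicategory)

variable (B) in
/-- The inclusion of `B` in the bicategory of comonads in `B`, sending `b` to the identity
comonad on `b`. -/
def comonadInclusion : B ⥤ᵖ ComonadBicat B where
  obj b := mkOfComonad (𝟙 b)
  map f := inclusionMap f
  map₂ {a b f g} η := comonadMap₂ (k := inclusionMap f) (l := inclusionMap g) η (by
    change 𝟙 a ◁ η ≫ (λ_ g).hom ≫ (ρ_ g).inv = ((λ_ f).hom ≫ (ρ_ f).inv) ≫ η ▷ 𝟙 b
    simp)
  map₂_id f := rfl
  map₂_comp f g := rfl
  mapId b := Oplax.OplaxTrans.isoMk (fun _ => Iso.refl (𝟙 b)) (fun _ => by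
    change 𝟙 b ◁ 𝟙 (𝟙 b) ≫ (ρ_ (𝟙 b)).hom ≫ (λ_ (𝟙 b)).inv =
      ((λ_ (𝟙 b)).hom ≫ (ρ_ (𝟙 b)).inv) ≫ 𝟙 (𝟙 b) ▷ 𝟙 b
    bicategory)
  mapComp {a b c} f g := Oplax.OplaxTrans.isoMk (fun _ => Iso.refl (f ≫ g)) (fun _ => by
    change 𝟙 a ◁ 𝟙 (f ≫ g) ≫ (α_ (𝟙 a) f g).inv ≫ ((λ_ f).hom ≫ (ρ_ f).inv) ▷ g ≫
      (α_ f (𝟙 b) g).hom ≫ f ◁ ((λ_ g).hom ≫ (ρ_ g).inv) ≫ (α_ f g (𝟙 c)).inv =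
      ((λ_ (f ≫ g)).hom ≫ (ρ_ (f ≫ g)).inv) ≫ 𝟙 (f ≫ g) ▷ 𝟙 c
    bicategory)
  map₂_whisker_left f g h η := Oplax.OplaxTrans.homCategory.ext fun _ => by
    change f ◁ η = 𝟙 _ ≫ f ◁ η ≫ 𝟙 _
    simp
  map₂_whisker_right η h := Oplax.OplaxTrans.homCategory.ext fun _ => by
    change η ▷ h = 𝟙 _ ≫ η ▷ h ≫ 𝟙 _
    simp
  map₂_associator f g h := Oplax.OplaxTrans.homCategory.ext fun _ => by
    change (α_ f g h).hom = 𝟙 _ ≫ 𝟙 _ ▷ h ≫ (α_ f g h).hom ≫ f ◁ 𝟙 _ ≫ 𝟙 _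
    simp
  map₂_left_unitor {a b} f := Oplax.OplaxTrans.homCategory.ext fun _ => by
    change (λ_ f).hom = 𝟙 _ ≫ 𝟙 (𝟙 a) ▷ f ≫ (λ_ f).hom
    simp
  map₂_right_unitor {a b} f := Oplax.OplaxTrans.homCategory.ext fun _ => by
    change (ρ_ f).hom = 𝟙 _ ≫ f ◁ 𝟙 (𝟙 b) ≫ (ρ_ f).hom
    simp

variable (B) in
/-- `B` admits the Eilenberg–Moore construction for comonads: the inclusion of `B` in the
bicategory of comonads in `B` has a right biadjoint. -/
def AdmitsEilenbergMoore : Prop :=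
  Nonempty (RightBiadjoint (comonadInclusion B))

/-- A coalgebra for a comonad `t` on `a`, i.e. a comonad map `(x, 1) ⟶ (a, t)`, from a 1-cell
`k : x ⟶ a` with a coaction `γ : k ⟶ k ≫ t`. -/
def coalgebra {x a : B} {t : a ⟶ a} [Comonad t] (k : x ⟶ a) (γ : k ⟶ k ≫ t)
    (h_counit : γ ≫ k ◁ Comonad.counit = (ρ_ k).inv)
    (h_comul : γ ≫ k ◁ Comonad.comul = γ ≫ γ ▷ t ≫ (α_ k t t).hom) :
    (comonadInclusion B).obj x ⟶ mkOfComonad t :=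
  comonadMap (s := 𝟙 x) k ((λ_ k).hom ≫ γ)
    (by
      change ((λ_ k).hom ≫ γ) ≫ _ = 𝟙 (𝟙 x) ▷ k ≫ _
      simp [h_counit])
    (by
      change ((λ_ k).hom ≫ γ) ≫ _ = (λ_ (𝟙 x)).inv ▷ k ≫ _
      rw [Category.assoc, h_comul]
      calc _ = (λ_ k).hom ≫ γ ≫ γ ▷ t ≫ (α_ k t t).hom := rfl
        _ = 𝟙 x ◁ γ ≫ (λ_ (k ≫ t)).hom ≫ γ ▷ t ≫ (α_ k t t).hom := by
          rw [leftUnitor_naturality_assoc]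
        _ = _ := by bicategory)

/-- A coalgebra `u` for a comonad, with domain `x`, exhibits `x` as an Eilenberg–Moore object of
the comonad: for all `y`, composing with `u` is an equivalence from the category of 1-cells
`y ⟶ x` to the category of coalgebras with domain `y`. -/
def IsUniversalCoalgebra {x : B} {m : ComonadBicat B} (u : (comonadInclusion B).obj x ⟶ m) :
    Prop :=
  ∀ y : B, (postcompAfter (comonadInclusion B) y u).IsEquivalence

/-- The comonad on `b` induced by an adjunction `l ⊣ r` with `l : a ⟶ b`. -/
@[reducible]
def adjunctionComonad {a b : B} {l : a ⟶ b} {r : b ⟶ a} (adj : Adjunction l r) :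
    Comonad (r ≫ l) where
  counit := adj.counit
  comul := r ◁ (λ_ l).inv ≫ r ◁ adj.unit ▷ l ≫ r ◁ (α_ l r l).hom ≫ (α_ r l (r ≫ l)).inv
  counit_comul := by
    have h := adj.right_triangle
    change (r ◁ (λ_ l).inv ≫ r ◁ adj.unit ▷ l ≫ r ◁ (α_ l r l).hom ≫ (α_ r l (r ≫ l)).inv) ≫
      adj.counit ▷ (r ≫ l) = (λ_ (r ≫ l)).inv
    calc _ = 𝟙 _ ⊗≫ rightZigzag adj.unit adj.counit ▷ l ⊗≫ 𝟙 _ := by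
          dsimp only [rightZigzag]; bicategory
      _ = _ := by rw [h]; bicategory
  comul_counit := by
    have h := adj.left_triangle
    change (r ◁ (λ_ l).inv ≫ r ◁ adj.unit ▷ l ≫ r ◁ (α_ l r l).hom ≫ (α_ r l (r ≫ l)).inv) ≫
      (r ≫ l) ◁ adj.counit = (ρ_ (r ≫ l)).inv
    calc _ = 𝟙 _ ⊗≫ r ◁ leftZigzag adj.unit adj.counit ⊗≫ 𝟙 _ := by
          dsimp only [leftZigzag]; bicategory
      _ = _ := by rw [h]; bicategory
  comul_assoc := by
    change (r ◁ (λ_ l).inv ≫ r ◁ adj.unit ▷ l ≫ r ◁ (α_ l r l).hom ≫ (α_ r l (r ≫ l)).inv) ≫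
      (r ≫ l) ◁ (r ◁ (λ_ l).inv ≫ r ◁ adj.unit ▷ l ≫ r ◁ (α_ l r l).hom ≫
        (α_ r l (r ≫ l)).inv) =
      (r ◁ (λ_ l).inv ≫ r ◁ adj.unit ▷ l ≫ r ◁ (α_ l r l).hom ≫ (α_ r l (r ≫ l)).inv) ≫
      (r ◁ (λ_ l).inv ≫ r ◁ adj.unit ▷ l ≫ r ◁ (α_ l r l).hom ≫
        (α_ r l (r ≫ l)).inv) ▷ (r ≫ l) ≫ (α_ (r ≫ l) (r ≫ l) (r ≫ l)).hom
    calc _ = 𝟙 _ ⊗≫ r ◁ (adj.unit ▷ 𝟙 a ≫ (l ≫ r) ◁ adj.unit) ▷ l ⊗≫ 𝟙 _ := by bicategory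
      _ = _ := by rw [← whisker_exchange]; bicategory

/-- The comonad on `b` induced by an adjunction `l ⊣ r`, as an object of the category of comonads
on `b`. -/
def inducedComonad {a b : B} {l : a ⟶ b} {r : b ⟶ a} (adj : Adjunction l r) : Comon (b ⟶ b) :=
  letI := adjunctionComonad adj
  ⟨r ≫ l⟩

end

end Bicategory
end CategoryTheory


namespace CategoryTheory

open MonoidalCategory Limits ComonObj

/-- Every functor `X ⊗ -` preserves equalizers of coreflexive pairs. -/
class TensorPreservesCoreflexiveEqualizers (V : Type u) [Category.{v} V] [MonoidalCategory V] :
    Prop where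
  preserves : ∀ (X : V) ⦃Y Z : V⦄ (f g : Y ⟶ Z) [IsCoreflexivePair f g],
    PreservesLimit (parallelPair f g) (tensorLeft X)

/-- A comodule from `A` to `B`: an object `X` with a left `A`-coaction and a right `B`-coaction
which commute with each other; equivalently, a coalgebra `X ⟶ A ⊗ X ⊗ B` for the comonad
`A ⊗ - ⊗ B`. -/
structure Bicomod {V : Type u} [Category.{v} V] [MonoidalCategory V] (A B : Comon V) where
  /-- The underlying object. -/
  X : V
  /-- The left coaction. -/
  coactL : X ⟶ A.X ⊗ X
  /-- The right coaction. -/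
  coactR : X ⟶ X ⊗ B.X
  coactL_counit : coactL ≫ ε[A.X] ▷ X = (λ_ X).inv
  coactL_coassoc : coactL ≫ A.X ◁ coactL = coactL ≫ Δ[A.X] ▷ X ≫ (α_ A.X A.X X).hom
  coactR_counit : coactR ≫ X ◁ ε[B.X] = (ρ_ X).inv
  coactR_coassoc : coactR ≫ coactR ▷ B.X = coactR ≫ X ◁ Δ[B.X] ≫ (α_ X B.X B.X).inv
  coact_comm : coactL ≫ A.X ◁ coactR = coactR ≫ coactL ▷ B.X ≫ (α_ A.X X B.X).hom

namespace Bicomod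

variable {V : Type u} [Category.{v} V] [MonoidalCategory V]

attribute [simp] coactL_counit coactR_counit

@[simp]
lemma coactL_counit_assoc : type_of% (reassoc_of% @coactL_counit) :=
  @(reassoc_of% @coactL_counit)

@[simp]
lemma coactR_counit_assoc : type_of% (reassoc_of% @coactR_counit) :=
  @(reassoc_of% @coactR_counit)




/-- Morphisms of comodules: maps that respect both coactions. -/
@[ext]
structure Hom {A B : Comon V} (M N : Bicomod A B) where
  /-- The underlying map. -/
  hom : M.X ⟶ N.X
  hom_coactL : hom ≫ N.coactL = M.coactL ≫ A.X ◁ hom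
  hom_coactR : hom ≫ N.coactR = M.coactR ≫ hom ▷ B.X


lemma Hom.hom_coactL_assoc : type_of% (reassoc_of% @Hom.hom_coactL) :=
  @(reassoc_of% @Hom.hom_coactL)

lemma Hom.hom_coactR_assoc : type_of% (reassoc_of% @Hom.hom_coactR) :=
  @(reassoc_of% @Hom.hom_coactR)

instance {A B : Comon V} : Category (Bicomod A B) where
  Hom := Hom
  id M := { hom := 𝟙 M.X, hom_coactL := by simp, hom_coactR := by simp }
  comp f g :=
    { hom := f.hom ≫ g.hom
      hom_coactL := by simp [g.hom_coactL, f.hom_coactL_assoc]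
      hom_coactR := by simp [g.hom_coactR, f.hom_coactR_assoc] }

@[ext]
lemma hom_ext {A B : Comon V} {M N : Bicomod A B} {f g : M ⟶ N} (h : f.hom = g.hom) : f = g :=
  Hom.ext h

@[simp]
lemma id_hom {A B : Comon V} (M : Bicomod A B) : Hom.hom (𝟙 M) = 𝟙 M.X := rfl

@[simp]
lemma comp_hom {A B : Comon V} {M N P : Bicomod A B} (f : M ⟶ N) (g : N ⟶ P) :
    (f ≫ g).hom = f.hom ≫ g.hom := rfl

/-- An isomorphism in `V` that respects the coactions is an isomorphism of comodules. -/
def isoMk {A B : Comon V} {M N : Bicomod A B} (f : M ⟶ N) (g : N.X ⟶ M.X)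
    (hfg : f.hom ≫ g = 𝟙 _) (hgf : g ≫ f.hom = 𝟙 _) : M ≅ N where
  hom := f
  inv :=
    { hom := g
      hom_coactL := by
        have h := f.hom_coactL
        calc g ≫ M.coactL = g ≫ (M.coactL ≫ A.X ◁ f.hom) ≫ A.X ◁ g := by
              simp [← whiskerLeft_comp, hfg]
          _ = N.coactL ≫ A.X ◁ g := by
              rw [← h, Category.assoc, ← Category.assoc, hgf, Category.id_comp]
      hom_coactR := by
        have h := f.hom_coactR
        calc g ≫ M.coactR = g ≫ (M.coactR ≫ f.hom ▷ B.X) ≫ g ▷ B.X := by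
              simp [← comp_whiskerRight, hfg]
          _ = N.coactR ≫ g ▷ B.X := by
              rw [← h, Category.assoc, ← Category.assoc, hgf, Category.id_comp] }
  hom_inv_id := hom_ext hfg
  inv_hom_id := hom_ext hgf

/-- A comonoid as a comodule over itself, with coactions given by the comultiplication. -/
@[simps]
abbrev regular (A : Comon V) : Bicomod A A where
  X := A.X
  coactL := Δ[A.X]
  coactR := Δ[A.X]
  coactL_counit := by simp
  coactL_coassoc := by simp
  coactR_counit := by simp
  coactR_coassoc := by simp
  coact_comm := by simp

section Tensor

variable {A B C D E : Comon V}

/-- The map `M ⊗ N ⟶ M ⊗ B ⊗ N` given by the right coaction on `M`. -/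
abbrev tensorFst (M : Bicomod A B) (N : Bicomod B C) : M.X ⊗ N.X ⟶ M.X ⊗ B.X ⊗ N.X :=
  M.coactR ▷ N.X ≫ (α_ M.X B.X N.X).hom

/-- The map `M ⊗ N ⟶ M ⊗ B ⊗ N` given by the left coaction on `N`. -/
abbrev tensorSnd (M : Bicomod A B) (N : Bicomod B C) : M.X ⊗ N.X ⟶ M.X ⊗ B.X ⊗ N.X :=
  M.X ◁ N.coactL

instance (M : Bicomod A B) (N : Bicomod B C) :
    IsCoreflexivePair (tensorFst M N) (tensorSnd M N) :=
  IsCoreflexivePair.mk' (M.X ◁ ε[B.X] ▷ N.X ≫ M.X ◁ (λ_ N.X).hom)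
    (by
      have h : M.coactR ▷ N.X ≫ (M.X ◁ ε[B.X]) ▷ N.X = (ρ_ M.X).inv ▷ N.X := by
        rw [← comp_whiskerRight, coactR_counit]
      calc _ = (M.coactR ▷ N.X ≫ (M.X ◁ ε[B.X]) ▷ N.X) ≫
            (α_ _ _ _).hom ≫ M.X ◁ (λ_ N.X).hom := by simp
        _ = _ := by rw [h]; simp)
    (by simp [← whiskerLeft_comp])

variable [HasCoreflexiveEqualizers V]

/-- The underlying object of the tensor product `M ⊗_B N`, an equalizer. -/
noncomputable def tensorX (M : Bicomod A B) (N : Bicomod B C) : V :=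
  equalizer (tensorFst M N) (tensorSnd M N)

/-- The inclusion of `M ⊗_B N` in `M ⊗ N`. -/
noncomputable def ιX (M : Bicomod A B) (N : Bicomod B C) : tensorX M N ⟶ M.X ⊗ N.X :=
  equalizer.ι (tensorFst M N) (tensorSnd M N)

variable (M : Bicomod A B) (N : Bicomod B C)

instance : Mono (ιX M N) := inferInstanceAs (Mono (equalizer.ι _ _))

lemma ιX_condition :
    ιX M N ≫ M.coactR ▷ N.X ≫ (α_ M.X B.X N.X).hom = ιX M N ≫ M.X ◁ N.coactL :=
  equalizer.condition (tensorFst M N) (tensorSnd M N)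



variable {M N} in
/-- The universal property of `M ⊗_B N`. -/
noncomputable def liftX {T : V} (h : T ⟶ M.X ⊗ N.X)
    (w : h ≫ M.coactR ▷ N.X ≫ (α_ M.X B.X N.X).hom = h ≫ M.X ◁ N.coactL) : T ⟶ tensorX M N :=
  equalizer.lift h w

variable {M N} in
@[simp]
lemma liftX_ιX {T : V} (h : T ⟶ M.X ⊗ N.X)
    (w : h ≫ M.coactR ▷ N.X ≫ (α_ M.X B.X N.X).hom = h ≫ M.X ◁ N.coactL) :
    liftX h w ≫ ιX M N = h :=
  equalizer.lift_ι h w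

@[simp]
lemma liftX_ιX_assoc : type_of% (reassoc_of% @liftX_ιX) :=
  @(reassoc_of% @liftX_ιX)

lemma map_lift_exists (F : V ⥤ V) [PreservesLimit (parallelPair (tensorFst M N) (tensorSnd M N)) F]
    {T : V} (h : T ⟶ F.obj (M.X ⊗ N.X))
    (w : h ≫ F.map (tensorFst M N) = h ≫ F.map (tensorSnd M N)) :
    ∃ l : T ⟶ F.obj (tensorX M N), l ≫ F.map (ιX M N) = h :=
  let L := isLimitOfHasEqualizerOfPreservesLimit F (tensorFst M N) (tensorSnd M N)
  ⟨Fork.IsLimit.lift L h w, Fork.IsLimit.lift_ι L⟩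

lemma mono_map_ιX (F : V ⥤ V) [PreservesLimit (parallelPair (tensorFst M N) (tensorSnd M N)) F] :
    Mono (F.map (ιX M N)) :=
  mono_of_isLimit_fork (isLimitOfHasEqualizerOfPreservesLimit F (tensorFst M N) (tensorSnd M N))

variable [TensorPreservesCoreflexiveEqualizers V]

instance (X : V) : PreservesLimit (parallelPair (tensorFst M N) (tensorSnd M N)) (tensorLeft X) :=
  TensorPreservesCoreflexiveEqualizers.preserves X _ _

instance (X : V) : Mono (X ◁ ιX M N) := mono_map_ιX M N (tensorLeft X)

variable {M N} in
lemma liftL_exists {X T : V} (h : T ⟶ X ⊗ M.X ⊗ N.X)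
    (w : h ≫ X ◁ M.coactR ▷ N.X ≫ X ◁ (α_ M.X B.X N.X).hom = h ≫ X ◁ M.X ◁ N.coactL) :
    ∃ l : T ⟶ X ⊗ tensorX M N, l ≫ X ◁ ιX M N = h :=
  map_lift_exists M N (tensorLeft X) h (by simpa using w)

variable {M N} in
/-- The universal property of `X ⊗ (M ⊗_B N)`. -/
noncomputable def liftL {X T : V} (h : T ⟶ X ⊗ M.X ⊗ N.X)
    (w : h ≫ X ◁ M.coactR ▷ N.X ≫ X ◁ (α_ M.X B.X N.X).hom = h ≫ X ◁ M.X ◁ N.coactL) :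
    T ⟶ X ⊗ tensorX M N :=
  (liftL_exists h w).choose

variable {M N} in
@[simp]
lemma liftL_ιX {X T : V} (h : T ⟶ X ⊗ M.X ⊗ N.X)
    (w : h ≫ X ◁ M.coactR ▷ N.X ≫ X ◁ (α_ M.X B.X N.X).hom = h ≫ X ◁ M.X ◁ N.coactL) :
    liftL h w ≫ X ◁ ιX M N = h :=
  (liftL_exists h w).choose_spec

@[simp]
lemma liftL_ιX_assoc : type_of% (reassoc_of% @liftL_ιX) :=
  @(reassoc_of% @liftL_ιX)

variable [BraidedCategory V]

instance (Y : V) : PreservesLimit (parallelPair (tensorFst M N) (tensorSnd M N)) (tensorRight Y) :=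
  preservesLimit_of_natIso _ (BraidedCategory.tensorLeftIsoTensorRight Y)

instance (Y : V) : Mono (ιX M N ▷ Y) := mono_map_ιX M N (tensorRight Y)

instance (X Y : V) : Mono (X ◁ ιX M N ▷ Y) := by
  have : PreservesLimit (parallelPair (tensorFst M N) (tensorSnd M N))
      (tensorRight Y ⋙ tensorLeft X) :=
    preservesLimit_of_natIso _
      (tensorLeftTensor X Y ≪≫
        Functor.isoWhiskerRight (BraidedCategory.tensorLeftIsoTensorRight Y) (tensorLeft X))
  exact mono_map_ιX M N (tensorRight Y ⋙ tensorLeft X)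

instance (X Y : V) : Mono ((X ◁ ιX M N) ▷ Y) := by
  have h : (X ◁ ιX M N) ▷ Y = (α_ _ _ _).hom ≫ X ◁ ιX M N ▷ Y ≫ (α_ _ _ _).inv := by simp
  rw [h]; infer_instance

instance (X Y : V) : Mono (ιX M N ▷ X ▷ Y) := by
  have h : ιX M N ▷ X ▷ Y = (α_ _ _ _).hom ≫ ιX M N ▷ (X ⊗ Y) ≫ (α_ _ _ _).inv := by simp
  rw [h]; infer_instance

instance (X Y : V) : Mono (X ◁ Y ◁ ιX M N) := by
  have h : X ◁ Y ◁ ιX M N = (α_ _ _ _).inv ≫ (X ⊗ Y) ◁ ιX M N ≫ (α_ _ _ _).hom := by simp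
  rw [h]; infer_instance

variable {M N} in
lemma liftR_exists {Y T : V} (h : T ⟶ (M.X ⊗ N.X) ⊗ Y)
    (w : h ≫ M.coactR ▷ N.X ▷ Y ≫ (α_ M.X B.X N.X).hom ▷ Y = h ≫ (M.X ◁ N.coactL) ▷ Y) :
    ∃ l : T ⟶ tensorX M N ⊗ Y, l ≫ ιX M N ▷ Y = h :=
  map_lift_exists M N (tensorRight Y) h (by simpa using w)

variable {M N} in
/-- The universal property of `(M ⊗_B N) ⊗ Y`. -/
noncomputable def liftR {Y T : V} (h : T ⟶ (M.X ⊗ N.X) ⊗ Y)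
    (w : h ≫ M.coactR ▷ N.X ▷ Y ≫ (α_ M.X B.X N.X).hom ▷ Y = h ≫ (M.X ◁ N.coactL) ▷ Y) :
    T ⟶ tensorX M N ⊗ Y :=
  (liftR_exists h w).choose

variable {M N} in
@[simp]
lemma liftR_ιX {Y T : V} (h : T ⟶ (M.X ⊗ N.X) ⊗ Y)
    (w : h ≫ M.coactR ▷ N.X ▷ Y ≫ (α_ M.X B.X N.X).hom ▷ Y = h ≫ (M.X ◁ N.coactL) ▷ Y) :
    liftR h w ≫ ιX M N ▷ Y = h :=
  (liftR_exists h w).choose_spec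

@[simp]
lemma liftR_ιX_assoc : type_of% (reassoc_of% @liftR_ιX) :=
  @(reassoc_of% @liftR_ιX)

/-- The left coaction on `M ⊗_B N`. -/
noncomputable def tensorCoactL : tensorX M N ⟶ A.X ⊗ tensorX M N :=
  liftL (ιX M N ≫ M.coactL ▷ N.X ≫ (α_ A.X M.X N.X).hom) (by
    have h1 := ιX_condition M N
    have h2 : M.coactL ▷ N.X ≫ (A.X ◁ M.coactR) ▷ N.X =
        M.coactR ▷ N.X ≫ M.coactL ▷ B.X ▷ N.X ≫ (α_ A.X M.X B.X).hom ▷ N.X := by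
      simp only [← comp_whiskerRight, coact_comm]
    calc _ = ιX M N ≫ (M.coactL ▷ N.X ≫ (A.X ◁ M.coactR) ▷ N.X) ≫ (α_ _ _ _).hom ≫
          A.X ◁ (α_ M.X B.X N.X).hom := by simp
      _ = (ιX M N ≫ M.coactR ▷ N.X ≫ (α_ M.X B.X N.X).hom) ≫ M.coactL ▷ (B.X ⊗ N.X) ≫
          (α_ _ _ _).hom := by rw [h2]; simp
      _ = _ := by
        rw [h1, Category.assoc, whisker_exchange_assoc]; simp)

@[simp]
lemma tensorCoactL_ιX : tensorCoactL M N ≫ A.X ◁ ιX M N =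
    ιX M N ≫ M.coactL ▷ N.X ≫ (α_ A.X M.X N.X).hom := liftL_ιX _ _

@[simp]
lemma tensorCoactL_ιX_assoc : type_of% (reassoc_of% @tensorCoactL_ιX) :=
  @(reassoc_of% @tensorCoactL_ιX)

/-- The right coaction on `M ⊗_B N`. -/
noncomputable def tensorCoactR : tensorX M N ⟶ tensorX M N ⊗ C.X :=
  liftR (ιX M N ≫ M.X ◁ N.coactR ≫ (α_ M.X N.X C.X).inv) (by
    have h1 := ιX_condition M N
    have h2 : M.X ◁ N.coactL ≫ M.X ◁ B.X ◁ N.coactR =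
        M.X ◁ N.coactR ≫ M.X ◁ N.coactL ▷ C.X ≫ M.X ◁ (α_ B.X N.X C.X).hom := by
      simp only [← whiskerLeft_comp, coact_comm]
    have h3 : M.X ◁ N.coactR ≫ M.X ◁ N.coactL ▷ C.X =
        M.X ◁ N.coactL ≫ M.X ◁ B.X ◁ N.coactR ≫ M.X ◁ (α_ B.X N.X C.X).inv := by
      rw [reassoc_of% h2]; simp [← whiskerLeft_comp]
    have h4 : M.X ◁ N.coactR ≫ (α_ M.X N.X C.X).inv ≫ M.coactR ▷ N.X ▷ C.X =
        M.coactR ▷ N.X ≫ (M.X ⊗ B.X) ◁ N.coactR ≫ (α_ _ _ _).inv := by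
      rw [← associator_inv_naturality_left, ← whisker_exchange_assoc]
    calc _ = ιX M N ≫ (M.X ◁ N.coactR ≫ (α_ M.X N.X C.X).inv ≫ M.coactR ▷ N.X ▷ C.X) ≫
            (α_ M.X B.X N.X).hom ▷ C.X := by simp
      _ = (ιX M N ≫ M.coactR ▷ N.X ≫ (α_ M.X B.X N.X).hom) ≫ M.X ◁ B.X ◁ N.coactR ≫
            M.X ◁ (α_ B.X N.X C.X).inv ≫ (α_ _ _ _).inv := by
            rw [h4]; simp
      _ = ιX M N ≫ (M.X ◁ N.coactR ≫ M.X ◁ N.coactL ▷ C.X) ≫ (α_ _ _ _).inv := by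
          rw [h1, h3]; simp
      _ = _ := by simp)

@[simp]
lemma tensorCoactR_ιX : tensorCoactR M N ≫ ιX M N ▷ C.X =
    ιX M N ≫ M.X ◁ N.coactR ≫ (α_ M.X N.X C.X).inv := liftR_ιX _ _

@[simp]
lemma tensorCoactR_ιX_assoc : type_of% (reassoc_of% @tensorCoactR_ιX) :=
  @(reassoc_of% @tensorCoactR_ιX)


/-- The tensor product of comodules over a comonoid. -/
noncomputable def tensor : Bicomod A C where
  X := tensorX M N
  coactL := tensorCoactL M N
  coactR := tensorCoactR M N
  coactL_counit := by
    rw [← cancel_mono (𝟙_ V ◁ ιX M N)]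
    have h : M.coactL ▷ N.X ≫ ε[A.X] ▷ M.X ▷ N.X = (λ_ M.X).inv ▷ N.X := by
      rw [← comp_whiskerRight, coactL_counit]
    calc _ = (tensorCoactL M N ≫ A.X ◁ ιX M N) ≫ ε[A.X] ▷ (M.X ⊗ N.X) := by
          rw [Category.assoc, Category.assoc, ← whisker_exchange]
      _ = ιX M N ≫ (M.coactL ▷ N.X ≫ ε[A.X] ▷ M.X ▷ N.X) ≫ (α_ _ _ _).hom := by
          rw [tensorCoactL_ιX]; simp
      _ = _ := by rw [h]; simp
  coactL_coassoc := by
    rw [← cancel_mono (A.X ◁ A.X ◁ ιX M N)]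
    have h : M.coactL ▷ N.X ≫ (A.X ◁ M.coactL) ▷ N.X =
        M.coactL ▷ N.X ≫ Δ[A.X] ▷ M.X ▷ N.X ≫ (α_ A.X A.X M.X).hom ▷ N.X := by
      simp only [← comp_whiskerRight, coactL_coassoc]
    calc _ = (tensorCoactL M N ≫ A.X ◁ ιX M N) ≫ A.X ◁ M.coactL ▷ N.X ≫
            A.X ◁ (α_ A.X M.X N.X).hom := by
          simp only [Category.assoc, ← whiskerLeft_comp, tensorCoactL_ιX]; simp
      _ = ιX M N ≫ (M.coactL ▷ N.X ≫ (A.X ◁ M.coactL) ▷ N.X) ≫ (α_ _ _ _).hom ≫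
            A.X ◁ (α_ A.X M.X N.X).hom := by
          rw [tensorCoactL_ιX]; simp
      _ = (tensorCoactL M N ≫ A.X ◁ ιX M N) ≫ Δ[A.X] ▷ (M.X ⊗ N.X) ≫ (α_ _ _ _).hom := by
          rw [h, tensorCoactL_ιX]; simp
      _ = _ := by
          rw [Category.assoc, whisker_exchange_assoc]; simp
  coactR_counit := by
    rw [← cancel_mono (ιX M N ▷ 𝟙_ V)]
    have h : M.X ◁ N.coactR ≫ M.X ◁ N.X ◁ ε[C.X] = M.X ◁ (ρ_ N.X).inv := by
      rw [← whiskerLeft_comp, coactR_counit]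
    calc _ = (tensorCoactR M N ≫ ιX M N ▷ C.X) ≫ (M.X ⊗ N.X) ◁ ε[C.X] := by
          rw [Category.assoc, Category.assoc, whisker_exchange]
      _ = ιX M N ≫ (M.X ◁ N.coactR ≫ M.X ◁ N.X ◁ ε[C.X]) ≫ (α_ _ _ _).inv := by
          rw [tensorCoactR_ιX]; simp
      _ = _ := by rw [h]; simp
  coactR_coassoc := by
    rw [← cancel_mono (ιX M N ▷ C.X ▷ C.X)]
    have h : M.X ◁ N.coactR ≫ M.X ◁ N.coactR ▷ C.X =
        M.X ◁ N.coactR ≫ M.X ◁ N.X ◁ Δ[C.X] ≫ M.X ◁ (α_ N.X C.X C.X).inv := by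
      simp only [← whiskerLeft_comp, coactR_coassoc]
    calc _ = (tensorCoactR M N ≫ ιX M N ▷ C.X) ≫ (M.X ◁ N.coactR) ▷ C.X ≫
            (α_ M.X N.X C.X).inv ▷ C.X := by
          simp only [Category.assoc, ← comp_whiskerRight, tensorCoactR_ιX]; simp
      _ = ιX M N ≫ (M.X ◁ N.coactR ≫ M.X ◁ N.coactR ▷ C.X) ≫ (α_ _ _ _).inv ≫
            (α_ M.X N.X C.X).inv ▷ C.X := by
          rw [tensorCoactR_ιX]; simp
      _ = (tensorCoactR M N ≫ ιX M N ▷ C.X) ≫ (M.X ⊗ N.X) ◁ Δ[C.X] ≫ (α_ _ _ _).inv := by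
          rw [h, tensorCoactR_ιX]; simp
      _ = _ := by
          rw [Category.assoc, ← whisker_exchange_assoc]; simp
  coact_comm := by
    rw [← cancel_mono (A.X ◁ ιX M N ▷ C.X)]
    have h : M.coactL ▷ N.X ≫ (α_ A.X M.X N.X).hom ≫ A.X ◁ M.X ◁ N.coactR =
        M.X ◁ N.coactR ≫ M.coactL ▷ (N.X ⊗ C.X) ≫ (α_ _ _ _).hom := by
      rw [whisker_exchange_assoc]; simp
    calc _ = (tensorCoactL M N ≫ A.X ◁ ιX M N) ≫ A.X ◁ M.X ◁ N.coactR ≫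
            A.X ◁ (α_ M.X N.X C.X).inv := by
          simp only [Category.assoc, ← whiskerLeft_comp, tensorCoactR_ιX]
      _ = ιX M N ≫ (M.coactL ▷ N.X ≫ (α_ A.X M.X N.X).hom ≫ A.X ◁ M.X ◁ N.coactR) ≫
            A.X ◁ (α_ M.X N.X C.X).inv := by
          rw [tensorCoactL_ιX]; simp
      _ = (tensorCoactR M N ≫ ιX M N ▷ C.X) ≫ M.coactL ▷ N.X ▷ C.X ≫
            (α_ A.X M.X N.X).hom ▷ C.X ≫ (α_ _ _ _).hom := by
          rw [h, tensorCoactR_ιX]; simp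
      _ = (tensorCoactR M N ≫ tensorCoactL M N ▷ C.X ≫ (A.X ◁ ιX M N) ▷ C.X) ≫ (α_ _ _ _).hom := by
          rw [← comp_whiskerRight, tensorCoactL_ιX]; simp
      _ = _ := by simp

/-- The inclusion of `M ⊗_B N` in `M ⊗ N`, the equalizer of the two coactions of `B`. -/
noncomputable def ι : (tensor M N).X ⟶ M.X ⊗ N.X := ιX M N

instance : Mono (ι M N) := inferInstanceAs (Mono (ιX M N))
instance (X : V) : Mono (X ◁ ι M N) := inferInstanceAs (Mono (X ◁ ιX M N))
instance (X : V) : Mono (ι M N ▷ X) := inferInstanceAs (Mono (ιX M N ▷ X))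
instance (X Y : V) : Mono (X ◁ ι M N ▷ Y) := inferInstanceAs (Mono (X ◁ ιX M N ▷ Y))
instance (X Y : V) : Mono ((X ◁ ι M N) ▷ Y) := inferInstanceAs (Mono ((X ◁ ιX M N) ▷ Y))
instance (X Y : V) : Mono (ι M N ▷ X ▷ Y) := inferInstanceAs (Mono (ιX M N ▷ X ▷ Y))
instance (X Y : V) : Mono (X ◁ Y ◁ ι M N) := inferInstanceAs (Mono (X ◁ Y ◁ ιX M N))

lemma ι_condition :
    ι M N ≫ M.coactR ▷ N.X ≫ (α_ M.X B.X N.X).hom = ι M N ≫ M.X ◁ N.coactL :=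
  ιX_condition M N



@[simp]
lemma coactL_ι : (tensor M N).coactL ≫ A.X ◁ ι M N =
    ι M N ≫ M.coactL ▷ N.X ≫ (α_ A.X M.X N.X).hom := tensorCoactL_ιX M N

@[simp]
lemma coactL_ι_assoc : type_of% (reassoc_of% @coactL_ι) :=
  @(reassoc_of% @coactL_ι)

@[simp]
lemma coactR_ι : (tensor M N).coactR ≫ ι M N ▷ C.X =
    ι M N ≫ M.X ◁ N.coactR ≫ (α_ M.X N.X C.X).inv := tensorCoactR_ιX M N

@[simp]
lemma coactR_ι_assoc : type_of% (reassoc_of% @coactR_ι) :=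
  @(reassoc_of% @coactR_ι)

variable {M N} {M' : Bicomod A B} {N' : Bicomod B C}

/-- The universal property of `M ⊗_B N`. -/
noncomputable def lift {T : V} (h : T ⟶ M.X ⊗ N.X)
    (w : h ≫ M.coactR ▷ N.X ≫ (α_ M.X B.X N.X).hom = h ≫ M.X ◁ N.coactL) : T ⟶ (tensor M N).X :=
  liftX h w

@[simp]
lemma lift_ι {T : V} (h : T ⟶ M.X ⊗ N.X)
    (w : h ≫ M.coactR ▷ N.X ≫ (α_ M.X B.X N.X).hom = h ≫ M.X ◁ N.coactL) :
    lift h w ≫ ι M N = h :=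
  liftX_ιX h w

@[simp]
lemma lift_ι_assoc : type_of% (reassoc_of% @lift_ι) :=
  @(reassoc_of% @lift_ι)

/-- The universal property of `X ⊗ (M ⊗_B N)`. -/
noncomputable def liftLeft {X T : V} (h : T ⟶ X ⊗ M.X ⊗ N.X)
    (w : h ≫ X ◁ M.coactR ▷ N.X ≫ X ◁ (α_ M.X B.X N.X).hom = h ≫ X ◁ M.X ◁ N.coactL) :
    T ⟶ X ⊗ (tensor M N).X :=
  liftL h w

@[simp]
lemma liftLeft_ι {X T : V} (h : T ⟶ X ⊗ M.X ⊗ N.X)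
    (w : h ≫ X ◁ M.coactR ▷ N.X ≫ X ◁ (α_ M.X B.X N.X).hom = h ≫ X ◁ M.X ◁ N.coactL) :
    liftLeft h w ≫ X ◁ ι M N = h :=
  liftL_ιX h w

@[simp]
lemma liftLeft_ι_assoc : type_of% (reassoc_of% @liftLeft_ι) :=
  @(reassoc_of% @liftLeft_ι)

/-- The universal property of `(M ⊗_B N) ⊗ Y`. -/
noncomputable def liftRight {Y T : V} (h : T ⟶ (M.X ⊗ N.X) ⊗ Y)
    (w : h ≫ M.coactR ▷ N.X ▷ Y ≫ (α_ M.X B.X N.X).hom ▷ Y = h ≫ (M.X ◁ N.coactL) ▷ Y) :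
    T ⟶ (tensor M N).X ⊗ Y :=
  liftR h w

@[simp]
lemma liftRight_ι {Y T : V} (h : T ⟶ (M.X ⊗ N.X) ⊗ Y)
    (w : h ≫ M.coactR ▷ N.X ▷ Y ≫ (α_ M.X B.X N.X).hom ▷ Y = h ≫ (M.X ◁ N.coactL) ▷ Y) :
    liftRight h w ≫ ι M N ▷ Y = h :=
  liftR_ιX h w

@[simp]
lemma liftRight_ι_assoc : type_of% (reassoc_of% @liftRight_ι) :=
  @(reassoc_of% @liftRight_ι)

/-- The tensor product of comodules, on maps in the right variable. -/
noncomputable def whiskerL (M : Bicomod A B) (g : N ⟶ N') : tensor M N ⟶ tensor M N' where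
  hom := lift (ι M N ≫ M.X ◁ g.hom) (by
    have h := ι_condition M N
    have hg : M.X ◁ N.coactL ≫ M.X ◁ B.X ◁ g.hom = M.X ◁ g.hom ≫ M.X ◁ N'.coactL := by
      simp only [← whiskerLeft_comp, g.hom_coactL]
    rw [Category.assoc, Category.assoc, whisker_exchange_assoc, ← hg, ← reassoc_of% h]
    simp)
  hom_coactL := by
    rw [← cancel_mono (A.X ◁ ι M N')]
    simp [← whiskerLeft_comp]
    simp [whisker_exchange_assoc]
  hom_coactR := by
    rw [← cancel_mono (ι M N' ▷ C.X)]
    have hg : M.X ◁ N.coactR ≫ M.X ◁ g.hom ▷ C.X = M.X ◁ g.hom ≫ M.X ◁ N'.coactR := by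
      simp only [← whiskerLeft_comp, g.hom_coactR]
    simp only [Category.assoc, ← comp_whiskerRight, coactR_ι, lift_ι_assoc, lift_ι]
    simp [reassoc_of% hg]

@[simp]
lemma whiskerL_ι (M : Bicomod A B) (g : N ⟶ N') :
    (whiskerL M g).hom ≫ ι M N' = ι M N ≫ M.X ◁ g.hom := lift_ι _ _

@[simp]
lemma whiskerL_ι_assoc : type_of% (reassoc_of% @whiskerL_ι) :=
  @(reassoc_of% @whiskerL_ι)

/-- The tensor product of comodules, on maps in the left variable. -/
noncomputable def whiskerR (f : M ⟶ M') (N : Bicomod B C) : tensor M N ⟶ tensor M' N where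
  hom := lift (ι M N ≫ f.hom ▷ N.X) (by
    have h := ι_condition M N
    have hf : f.hom ▷ N.X ≫ M'.coactR ▷ N.X = M.coactR ▷ N.X ≫ f.hom ▷ B.X ▷ N.X := by
      simp only [← comp_whiskerRight, f.hom_coactR]
    rw [Category.assoc, Category.assoc, ← whisker_exchange, ← reassoc_of% h, reassoc_of% hf]
    simp)
  hom_coactL := by
    rw [← cancel_mono (A.X ◁ ι M' N)]
    simp [← whiskerLeft_comp]
    simp [← comp_whiskerRight_assoc, f.hom_coactL]
  hom_coactR := by
    rw [← cancel_mono (ι M' N ▷ C.X)]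
    simp [← comp_whiskerRight]
    simp [← whisker_exchange_assoc]

@[simp]
lemma whiskerR_ι (f : M ⟶ M') (N : Bicomod B C) :
    (whiskerR f N).hom ≫ ι M' N = ι M N ≫ f.hom ▷ N.X := lift_ι _ _

@[simp]
lemma whiskerR_ι_assoc : type_of% (reassoc_of% @whiskerR_ι) :=
  @(reassoc_of% @whiskerR_ι)

/-- The inclusion of `(M ⊗_B N) ⊗_C P` in `M ⊗ N ⊗ P`. -/
noncomputable def ιL (M : Bicomod A B) (N : Bicomod B C) (P : Bicomod C D) :
    (tensor (tensor M N) P).X ⟶ M.X ⊗ N.X ⊗ P.X :=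
  ι (tensor M N) P ≫ ι M N ▷ P.X ≫ (α_ _ _ _).hom

/-- The inclusion of `M ⊗_B (N ⊗_C P)` in `M ⊗ N ⊗ P`. -/
noncomputable def ιR (M : Bicomod A B) (N : Bicomod B C) (P : Bicomod C D) :
    (tensor M (tensor N P)).X ⟶ M.X ⊗ N.X ⊗ P.X :=
  ι M (tensor N P) ≫ M.X ◁ ι N P

section

variable (M : Bicomod A B) (N : Bicomod B C) (P : Bicomod C D)

instance : Mono (ιL M N P) := by unfold ιL; infer_instance
instance : Mono (ιR M N P) := by unfold ιR; infer_instance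
instance (X : V) : Mono (X ◁ ιR M N P) := by
  unfold ιR; rw [whiskerLeft_comp]; infer_instance
instance (X : V) : Mono (ιR M N P ▷ X) := by
  unfold ιR; rw [comp_whiskerRight]; infer_instance

lemma ιL_coactL : (tensor (tensor M N) P).coactL ≫ A.X ◁ ιL M N P =
    ιL M N P ≫ M.coactL ▷ (N.X ⊗ P.X) ≫ (α_ _ _ _).hom := by
  have h : (tensor M N).coactL ▷ P.X ≫ (A.X ◁ ι M N) ▷ P.X =
      ι M N ▷ P.X ≫ M.coactL ▷ N.X ▷ P.X ≫ (α_ A.X M.X N.X).hom ▷ P.X := by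
    simp only [← comp_whiskerRight, coactL_ι]
  calc _ = ((tensor (tensor M N) P).coactL ≫ A.X ◁ ι _ _) ≫
        A.X ◁ (ι M N ▷ P.X) ≫ A.X ◁ (α_ _ _ _).hom := by simp [ιL]
    _ = ι _ _ ≫ ((tensor M N).coactL ▷ P.X ≫ (A.X ◁ ι M N) ▷ P.X) ≫
        (α_ _ _ _).hom ≫ A.X ◁ (α_ _ _ _).hom := by rw [coactL_ι]; simp
    _ = _ := by rw [h]; simp [ιL]



lemma ιR_coactL : (tensor M (tensor N P)).coactL ≫ A.X ◁ ιR M N P =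
    ιR M N P ≫ M.coactL ▷ (N.X ⊗ P.X) ≫ (α_ _ _ _).hom := by
  calc _ = ((tensor M (tensor N P)).coactL ≫ A.X ◁ ι _ _) ≫ A.X ◁ (M.X ◁ ι N P) := by simp [ιR]
    _ = ι _ _ ≫ M.coactL ▷ _ ≫ (A.X ⊗ M.X) ◁ ι N P ≫ (α_ _ _ _).hom := by rw [coactL_ι]; simp
    _ = _ := by rw [← whisker_exchange_assoc]; simp [ιR]



lemma ιL_coactR : (tensor (tensor M N) P).coactR ≫ ιL M N P ▷ D.X =
    ιL M N P ≫ M.X ◁ N.X ◁ P.coactR ≫ M.X ◁ (α_ _ _ _).inv ≫ (α_ _ _ _).inv := by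
  calc _ = ((tensor (tensor M N) P).coactR ≫ ι _ _ ▷ D.X) ≫
        (ι M N ▷ P.X) ▷ D.X ≫ (α_ _ _ _).hom ▷ D.X := by simp [ιL]
    _ = ι _ _ ≫ ((tensor M N).X ◁ P.coactR ≫ ι M N ▷ (P.X ⊗ D.X)) ≫ (α_ _ _ _).inv ≫
        (α_ _ _ _).hom ▷ D.X := by rw [coactR_ι]; simp
    _ = _ := by rw [whisker_exchange]; simp [ιL]



lemma ιR_coactR : (tensor M (tensor N P)).coactR ≫ ιR M N P ▷ D.X =
    ιR M N P ≫ M.X ◁ N.X ◁ P.coactR ≫ M.X ◁ (α_ _ _ _).inv ≫ (α_ _ _ _).inv := by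
  have h : M.X ◁ (tensor N P).coactR ≫ M.X ◁ ι N P ▷ D.X =
      M.X ◁ ι N P ≫ M.X ◁ N.X ◁ P.coactR ≫ M.X ◁ (α_ _ _ _).inv := by
    simp only [← whiskerLeft_comp, coactR_ι]
  calc _ = ((tensor M (tensor N P)).coactR ≫ ι _ _ ▷ D.X) ≫ (M.X ◁ ι N P) ▷ D.X := by simp [ιR]
    _ = ι _ _ ≫ (M.X ◁ (tensor N P).coactR ≫ M.X ◁ ι N P ▷ D.X) ≫ (α_ _ _ _).inv := by
        rw [coactR_ι]; simp
    _ = _ := by rw [h]; simp [ιR]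



lemma ιL_condition₁ : ιL M N P ≫ M.X ◁ N.coactR ▷ P.X ≫ M.X ◁ (α_ _ _ _).hom =
    ιL M N P ≫ M.X ◁ N.X ◁ P.coactL := by
  have h : ι M N ▷ P.X ≫ (M.X ◁ N.coactR) ▷ P.X =
      (tensor M N).coactR ▷ P.X ≫ ι M N ▷ C.X ▷ P.X ≫ (α_ _ _ _).hom ▷ P.X := by
    simp only [← comp_whiskerRight, coactR_ι_assoc]
    simp
  calc _ = ι _ _ ≫ (ι M N ▷ P.X ≫ (M.X ◁ N.coactR) ▷ P.X) ≫ (α_ _ _ _).hom ≫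
        M.X ◁ (α_ _ _ _).hom := by simp [ιL]
    _ = (ι (tensor M N) P ≫ (tensor M N).coactR ▷ P.X ≫ (α_ _ _ _).hom) ≫
        ι M N ▷ (C.X ⊗ P.X) ≫ (α_ _ _ _).hom := by rw [h]; simp
    _ = _ := by
        rw [ι_condition, Category.assoc, whisker_exchange_assoc]; simp [ιL]

lemma ιL_condition₂ : ιL M N P ≫ M.coactR ▷ (N.X ⊗ P.X) ≫ (α_ _ _ _).hom =
    ιL M N P ≫ M.X ◁ N.coactL ▷ P.X ≫ M.X ◁ (α_ _ _ _).hom := by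
  have h : ι M N ▷ P.X ≫ M.coactR ▷ N.X ▷ P.X ≫ (α_ M.X B.X N.X).hom ▷ P.X =
      ι M N ▷ P.X ≫ (M.X ◁ N.coactL) ▷ P.X := by
    simp only [← comp_whiskerRight, ι_condition]
  calc _ = ι _ _ ≫ (ι M N ▷ P.X ≫ M.coactR ▷ N.X ▷ P.X ≫ (α_ M.X B.X N.X).hom ▷ P.X) ≫
        (α_ _ _ _).hom ≫ M.X ◁ (α_ _ _ _).hom := by simp [ιL]
    _ = _ := by rw [h]; simp [ιL]

lemma ιR_condition₁ : ιR M N P ≫ M.X ◁ N.coactR ▷ P.X ≫ M.X ◁ (α_ _ _ _).hom =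
    ιR M N P ≫ M.X ◁ N.X ◁ P.coactL := by
  simp only [ιR, Category.assoc, ← whiskerLeft_comp, ι_condition]

lemma ιR_condition₂ : ιR M N P ≫ M.coactR ▷ (N.X ⊗ P.X) ≫ (α_ _ _ _).hom =
    ιR M N P ≫ M.X ◁ N.coactL ▷ P.X ≫ M.X ◁ (α_ _ _ _).hom := by
  have h : M.X ◁ ι N P ≫ M.X ◁ N.coactL ▷ P.X ≫ M.X ◁ (α_ _ _ _).hom =
      M.X ◁ (tensor N P).coactL ≫ M.X ◁ B.X ◁ ι N P := by
    simp only [← whiskerLeft_comp, coactL_ι]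
  calc _ = ι M (tensor N P) ≫ (M.X ◁ ι N P ≫ M.coactR ▷ (N.X ⊗ P.X)) ≫ (α_ _ _ _).hom := by
        simp [ιR]
    _ = (ι M (tensor N P) ≫ M.coactR ▷ _ ≫ (α_ _ _ _).hom) ≫ M.X ◁ B.X ◁ ι N P := by
        rw [whisker_exchange]; simp
    _ = _ := by
        rw [ι_condition, Category.assoc, ← h]; simp [ιR]

end

/-- The map underlying the associativity isomorphism, from left to right. -/
noncomputable def assocFwd (M : Bicomod A B) (N : Bicomod B C) (P : Bicomod C D) :
    (tensor (tensor M N) P).X ⟶ (tensor M (tensor N P)).X :=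
  lift (liftLeft (ιL M N P) (ιL_condition₁ M N P)) (by
      rw [← cancel_mono (M.X ◁ B.X ◁ ι N P)]
      have h := ιL_condition₂ M N P
      have h' : M.X ◁ (tensor N P).coactL ≫ M.X ◁ B.X ◁ ι N P =
          M.X ◁ ι N P ≫ M.X ◁ N.coactL ▷ P.X ≫ M.X ◁ (α_ _ _ _).hom := by
        simp only [← whiskerLeft_comp, coactL_ι]
      simp only [Category.assoc]
      rw [h', liftLeft_ι_assoc, ← h,
        ← associator_naturality_right, ← whisker_exchange_assoc, liftLeft_ι_assoc])

@[simp]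
lemma assocFwd_ι (M : Bicomod A B) (N : Bicomod B C) (P : Bicomod C D) :
    assocFwd M N P ≫ ιR M N P = ιL M N P := by
  simp [assocFwd, ιR]

@[simp]
lemma assocFwd_ι_assoc : type_of% (reassoc_of% @assocFwd_ι) :=
  @(reassoc_of% @assocFwd_ι)

/-- The map underlying the associativity isomorphism, from right to left. -/
noncomputable def assocInv (M : Bicomod A B) (N : Bicomod B C) (P : Bicomod C D) :
    (tensor M (tensor N P)).X ⟶ (tensor (tensor M N) P).X :=
  lift (liftRight (ιR M N P ≫ (α_ _ _ _).inv) (by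
      have h := ιR_condition₂ M N P
      rw [← cancel_mono (α_ _ _ _).hom, ← cancel_mono (M.X ◁ (α_ _ _ _).hom)]
      simpa using h)) (by
      rw [← cancel_mono (ι M N ▷ (C.X ⊗ P.X)), ← cancel_mono (α_ _ _ _).hom]
      have h := ιR_condition₁ M N P
      have h' : (tensor M N).coactR ▷ P.X ≫ ι M N ▷ C.X ▷ P.X =
          ι M N ▷ P.X ≫ (M.X ◁ N.coactR) ▷ P.X ≫ (α_ _ _ _).inv ▷ P.X := by
        simp only [← comp_whiskerRight, coactR_ι]
      simp only [Category.assoc]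
      rw [← associator_naturality_left_assoc, reassoc_of% h', liftRight_ι_assoc,
        whisker_exchange_assoc, liftRight_ι_assoc]
      simpa using h)

@[simp]
lemma assocInv_ι (M : Bicomod A B) (N : Bicomod B C) (P : Bicomod C D) :
    assocInv M N P ≫ ιL M N P = ιR M N P := by
  simp [assocInv, ιL]

@[simp]
lemma assocInv_ι_assoc : type_of% (reassoc_of% @assocInv_ι) :=
  @(reassoc_of% @assocInv_ι)

/-- The tensor product of comodules is associative. -/
noncomputable def assocIso (M : Bicomod A B) (N : Bicomod B C) (P : Bicomod C D) :
    tensor (tensor M N) P ≅ tensor M (tensor N P) :=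
  isoMk
    { hom := assocFwd M N P
      hom_coactL := by
        rw [← cancel_mono (A.X ◁ ιR M N P), Category.assoc, Category.assoc, ιR_coactL,
          assocFwd_ι_assoc, ← whiskerLeft_comp, assocFwd_ι, ιL_coactL]
      hom_coactR := by
        rw [← cancel_mono (ιR M N P ▷ D.X), Category.assoc, Category.assoc, ιR_coactR,
          assocFwd_ι_assoc, ← comp_whiskerRight, assocFwd_ι, ιL_coactR] }
    (assocInv M N P)
    (by rw [← cancel_mono (ιL M N P)]; simp)
    (by rw [← cancel_mono (ιR M N P)]; simp)

@[simp]
lemma assocIso_hom_ι (M : Bicomod A B) (N : Bicomod B C) (P : Bicomod C D) :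
    (assocIso M N P).hom.hom ≫ ι M (tensor N P) ≫ M.X ◁ ι N P =
      ι (tensor M N) P ≫ ι M N ▷ P.X ≫ (α_ _ _ _).hom := assocFwd_ι M N P

@[simp]
lemma assocIso_hom_ι_assoc : type_of% (reassoc_of% @assocIso_hom_ι) :=
  @(reassoc_of% @assocIso_hom_ι)

/-- Comonoids are left units for the tensor product of comodules. -/
noncomputable def leftUnitorIso (M : Bicomod A B) : tensor (regular A) M ≅ M :=
  (isoMk
    { hom := lift (M := regular A) M.coactL (by simpa using M.coactL_coassoc.symm)
      hom_coactL := by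
        rw [← cancel_mono (A.X ◁ ι (regular A) M), Category.assoc, Category.assoc, coactL_ι,
          ← whiskerLeft_comp, lift_ι, lift_ι_assoc]
        exact M.coactL_coassoc.symm
      hom_coactR := by
        rw [← cancel_mono (ι (regular A) M ▷ B.X), Category.assoc, Category.assoc, coactR_ι,
          ← comp_whiskerRight, lift_ι, lift_ι_assoc]
        have h := M.coact_comm
        rw [reassoc_of% h]; simp }
    (ι (regular A) M ≫ ε[A.X] ▷ M.X ≫ (λ_ M.X).hom)
    (by simp)
    (by
      rw [← cancel_mono (ι (regular A) M), Category.assoc, lift_ι, Category.id_comp]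
      have h := ι_condition (regular A) M
      calc _ = (ι (regular A) M ≫ A.X ◁ M.coactL) ≫ ε[A.X] ▷ (A.X ⊗ M.X) ≫ (λ_ _).hom := by
            simp only [Category.assoc]; rw [whisker_exchange_assoc]; simp
        _ = ι (regular A) M ≫ (Δ[A.X] ≫ ε[A.X] ▷ A.X) ▷ M.X ≫ (λ_ A.X).hom ▷ M.X := by
            rw [← h]; simp [- counit_comul]
        _ = _ := by rw [counit_comul, ← comp_whiskerRight]; simp)).symm

@[simp]
lemma leftUnitorIso_hom_hom (M : Bicomod A B) :
    (leftUnitorIso M).hom.hom = ι (regular A) M ≫ ε[A.X] ▷ M.X ≫ (λ_ M.X).hom := rfl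

/-- Comonoids are right units for the tensor product of comodules. -/
noncomputable def rightUnitorIso (M : Bicomod A B) : tensor M (regular B) ≅ M :=
  (isoMk
    { hom := lift (N := regular B) M.coactR (by
        have h := M.coactR_coassoc
        rw [reassoc_of% h]; simp)
      hom_coactL := by
        rw [← cancel_mono (A.X ◁ ι M (regular B)), Category.assoc, Category.assoc, coactL_ι,
          ← whiskerLeft_comp, lift_ι, lift_ι_assoc]
        exact M.coact_comm.symm
      hom_coactR := by
        rw [← cancel_mono (ι M (regular B) ▷ B.X), Category.assoc, Category.assoc, coactR_ι,
          ← comp_whiskerRight, lift_ι, lift_ι_assoc]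
        exact M.coactR_coassoc.symm }
    (ι M (regular B) ≫ M.X ◁ ε[B.X] ≫ (ρ_ M.X).hom)
    (by simp)
    (by
      rw [← cancel_mono (ι M (regular B)), Category.assoc, lift_ι, Category.id_comp]
      have h := ι_condition M (regular B)
      calc _ = (ι M (regular B) ≫ M.coactR ▷ B.X) ≫ (M.X ⊗ B.X) ◁ ε[B.X] ≫ (ρ_ _).hom := by
            simp only [Category.assoc]; rw [← whisker_exchange_assoc]; simp
        _ = (ι M (regular B) ≫ M.coactR ▷ B.X ≫ (α_ _ _ _).hom) ≫ M.X ◁ B.X ◁ ε[B.X] ≫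
              M.X ◁ (ρ_ _).hom := by simp
        _ = ι M (regular B) ≫ M.X ◁ (Δ[B.X] ≫ B.X ◁ ε[B.X]) ≫ M.X ◁ (ρ_ B.X).hom := by
            rw [h]; simp [- comul_counit]
        _ = _ := by rw [comul_counit, ← whiskerLeft_comp]; simp)).symm

@[simp]
lemma rightUnitorIso_hom_hom (M : Bicomod A B) :
    (rightUnitorIso M).hom.hom = ι M (regular B) ≫ M.X ◁ ε[B.X] ≫ (ρ_ M.X).hom := rfl

end Tensor

section Coherence

variable {A B C D E : Comon V} [HasCoreflexiveEqualizers V]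
  [TensorPreservesCoreflexiveEqualizers V] [BraidedCategory V]

/-- A comodule map to `M ⊗_B N` given by a map to `M ⊗ N`. -/
noncomputable def homLift {T : Bicomod A C} {M : Bicomod A B} {N : Bicomod B C}
    (c : T.X ⟶ M.X ⊗ N.X)
    (w : c ≫ M.coactR ▷ N.X ≫ (α_ M.X B.X N.X).hom = c ≫ M.X ◁ N.coactL)
    (hL : c ≫ M.coactL ▷ N.X ≫ (α_ A.X M.X N.X).hom = T.coactL ≫ A.X ◁ c)
    (hR : c ≫ M.X ◁ N.coactR ≫ (α_ M.X N.X C.X).inv = T.coactR ≫ c ▷ C.X) :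
    Hom T (tensor M N) where
  hom := lift c w
  hom_coactL := by
    rw [← cancel_mono (A.X ◁ ι M N), Category.assoc, Category.assoc, coactL_ι, lift_ι_assoc,
      ← whiskerLeft_comp, lift_ι, hL]
  hom_coactR := by
    rw [← cancel_mono (ι M N ▷ C.X), Category.assoc, Category.assoc, coactR_ι, lift_ι_assoc,
      ← comp_whiskerRight, lift_ι, hR]

lemma tensor_hom_ext {X : Bicomod A C} {M : Bicomod A B} {N : Bicomod B C} {f g : X ⟶ tensor M N}
    (h : f.hom ≫ ι M N = g.hom ≫ ι M N) : f = g :=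
  hom_ext ((cancel_mono _).1 h)

lemma whiskerL_id (M : Bicomod A B) (N : Bicomod B C) : whiskerL M (𝟙 N) = 𝟙 _ :=
  tensor_hom_ext (by simp)

lemma id_whiskerR (M : Bicomod A B) (N : Bicomod B C) : whiskerR (𝟙 M) N = 𝟙 _ :=
  tensor_hom_ext (by simp)

lemma whiskerL_comp (M : Bicomod A B) {N N' N'' : Bicomod B C} (f : N ⟶ N') (g : N' ⟶ N'') :
    whiskerL M (f ≫ g) = whiskerL M f ≫ whiskerL M g :=
  tensor_hom_ext (by simp)

lemma comp_whiskerR {M M' M'' : Bicomod A B} (f : M ⟶ M') (g : M' ⟶ M'') (N : Bicomod B C) :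
    whiskerR (f ≫ g) N = whiskerR f N ≫ whiskerR g N :=
  tensor_hom_ext (by simp)

lemma whisker_exch {M M' : Bicomod A B} {N N' : Bicomod B C} (f : M ⟶ M') (g : N ⟶ N') :
    whiskerL M g ≫ whiskerR f N' = whiskerR f N ≫ whiskerL M' g :=
  tensor_hom_ext (by simp [whisker_exchange])

lemma tensor_hom_ext₃ {X : Bicomod A D} {M : Bicomod A B} {N : Bicomod B C} {P : Bicomod C D}
    {f g : X ⟶ tensor M (tensor N P)}
    (h : f.hom ≫ ι M (tensor N P) ≫ M.X ◁ ι N P = g.hom ≫ ι M (tensor N P) ≫ M.X ◁ ι N P) :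
    f = g :=
  hom_ext ((cancel_mono (ιR M N P)).1 h)

lemma whiskerL_ι_whisker (X : V) (M : Bicomod A B) {N N' : Bicomod B C} (g : N ⟶ N') :
    X ◁ (whiskerL M g).hom ≫ X ◁ ι M N' = X ◁ ι M N ≫ X ◁ M.X ◁ g.hom := by
  simp only [← whiskerLeft_comp, whiskerL_ι]

lemma whiskerR_ι_whisker (X : V) {M M' : Bicomod A B} (f : M ⟶ M') (N : Bicomod B C) :
    X ◁ (whiskerR f N).hom ≫ X ◁ ι M' N = X ◁ ι M N ≫ X ◁ f.hom ▷ N.X := by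
  simp only [← whiskerLeft_comp, whiskerR_ι]

lemma whiskerL_ι_whisker' (X : V) (M : Bicomod A B) {N N' : Bicomod B C} (g : N ⟶ N') :
    (whiskerL M g).hom ▷ X ≫ ι M N' ▷ X = ι M N ▷ X ≫ (M.X ◁ g.hom) ▷ X := by
  simp only [← comp_whiskerRight, whiskerL_ι]

lemma whiskerR_ι_whisker' (X : V) {M M' : Bicomod A B} (f : M ⟶ M') (N : Bicomod B C) :
    (whiskerR f N).hom ▷ X ≫ ι M' N ▷ X = ι M N ▷ X ≫ f.hom ▷ N.X ▷ X := by
  simp only [← comp_whiskerRight, whiskerR_ι]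

lemma assoc_nat₁ {M M' : Bicomod A B} (f : M ⟶ M') (N : Bicomod B C) (P : Bicomod C D) :
    whiskerR (whiskerR f N) P ≫ (assocIso M' N P).hom =
      (assocIso M N P).hom ≫ whiskerR f (tensor N P) := by
  apply tensor_hom_ext₃
  have h := whiskerR_ι_whisker' P.X f N
  simp only [comp_hom, Category.assoc, assocIso_hom_ι, whiskerR_ι_assoc, reassoc_of% h]
  rw [← whisker_exchange, assocIso_hom_ι_assoc]
  simp

lemma assoc_nat₂ (M : Bicomod A B) {N N' : Bicomod B C} (f : N ⟶ N') (P : Bicomod C D) :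
    whiskerR (whiskerL M f) P ≫ (assocIso M N' P).hom =
      (assocIso M N P).hom ≫ whiskerL M (whiskerR f P) := by
  apply tensor_hom_ext₃
  have h := whiskerL_ι_whisker' P.X M f
  have h' := whiskerR_ι_whisker M.X f P
  simp only [comp_hom, Category.assoc, assocIso_hom_ι, whiskerR_ι_assoc, reassoc_of% h,
    whiskerL_ι_assoc, h', assocIso_hom_ι_assoc]
  simp

lemma assoc_nat₃ (M : Bicomod A B) (N : Bicomod B C) {P P' : Bicomod C D} (f : P ⟶ P') :
    whiskerL (tensor M N) f ≫ (assocIso M N P').hom =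
      (assocIso M N P).hom ≫ whiskerL M (whiskerL N f) := by
  apply tensor_hom_ext₃
  have h' := whiskerL_ι_whisker M.X N f
  simp only [comp_hom, Category.assoc, assocIso_hom_ι,
    whiskerL_ι_assoc, h', assocIso_hom_ι_assoc]
  rw [whisker_exchange_assoc]
  simp

lemma leftUnitor_nat {M M' : Bicomod A B} (f : M ⟶ M') :
    whiskerL (regular A) f ≫ (leftUnitorIso M').hom = (leftUnitorIso M).hom ≫ f := by
  apply hom_ext
  have h : A.X ◁ f.hom ≫ ε[A.X] ▷ M'.X = ε[A.X] ▷ M.X ≫ 𝟙_ V ◁ f.hom := whisker_exchange _ _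
  simp [reassoc_of% h]

lemma rightUnitor_nat {M M' : Bicomod A B} (f : M ⟶ M') :
    whiskerR f (regular B) ≫ (rightUnitorIso M').hom = (rightUnitorIso M).hom ≫ f := by
  apply hom_ext
  have h : f.hom ▷ B.X ≫ M'.X ◁ ε[B.X] = M.X ◁ ε[B.X] ≫ f.hom ▷ 𝟙_ V :=
    (whisker_exchange _ _).symm
  simp [reassoc_of% h]

lemma triangle (M : Bicomod A B) (N : Bicomod B C) :
    (assocIso M (regular B) N).hom ≫ whiskerL M (leftUnitorIso N).hom =
      whiskerR (rightUnitorIso M).hom N := by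
  apply tensor_hom_ext
  have h := assocIso_hom_ι M (regular B) N
  simp only [comp_hom, Category.assoc, whiskerL_ι, whiskerR_ι, leftUnitorIso_hom_hom,
    rightUnitorIso_hom_hom, whiskerLeft_comp, comp_whiskerRight, reassoc_of% h]
  simp

lemma pentagon (M : Bicomod A B) (N : Bicomod B C) (P : Bicomod C D) (Q : Bicomod D E) :
    whiskerR (assocIso M N P).hom Q ≫ (assocIso M (tensor N P) Q).hom ≫
        whiskerL M (assocIso N P Q).hom =
      (assocIso (tensor M N) P Q).hom ≫ (assocIso M N (tensor P Q)).hom := by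
  apply tensor_hom_ext₃
  rw [← cancel_mono (M.X ◁ N.X ◁ ι P Q)]
  have h₁ : M.X ◁ (assocIso N P Q).hom.hom ≫ M.X ◁ ι N (tensor P Q) ≫ M.X ◁ N.X ◁ ι P Q =
      M.X ◁ ι (tensor N P) Q ≫ M.X ◁ ι N P ▷ Q.X ≫ M.X ◁ (α_ _ _ _).hom := by
    simp only [← whiskerLeft_comp, assocIso_hom_ι]
  have h₂ : (assocIso M N P).hom.hom ▷ Q.X ≫ ι M (tensor N P) ▷ Q.X ≫ (M.X ◁ ι N P) ▷ Q.X =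
      ι (tensor M N) P ▷ Q.X ≫ ι M N ▷ P.X ▷ Q.X ≫ (α_ _ _ _).hom ▷ Q.X := by
    simp only [← comp_whiskerRight, assocIso_hom_ι]
  simp only [comp_hom, Category.assoc, whiskerL_ι_assoc, h₁, assocIso_hom_ι_assoc]
  rw [← associator_naturality_middle_assoc, whiskerR_ι_assoc, reassoc_of% h₂,
    ← associator_naturality_right, ← whisker_exchange_assoc, assocIso_hom_ι_assoc]
  simp

end Coherence


end Bicomod

/-- The objects of the bicategory of comodules in `V`: the comonoids in `V`. -/
structure Comod (V : Type u) [Category.{v} V] [MonoidalCategory V] where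
  /-- The underlying comonoid. -/
  comon : Comon V

namespace Comod

variable {V : Type u} [Category.{v} V] [MonoidalCategory V] [BraidedCategory V]
  [HasCoreflexiveEqualizers V] [TensorPreservesCoreflexiveEqualizers V]

open Bicomod

/-- The bicategory of comonoids, comodules and comodule maps. -/
noncomputable instance : Bicategory (Comod V) where
  Hom A B := Bicomod A.comon B.comon
  id A := regular A.comon
  comp M N := tensor M N
  homCategory A B := inferInstanceAs (Category (Bicomod A.comon B.comon))
  whiskerLeft M _ _ g := whiskerL M g
  whiskerRight f N := whiskerR f N
  associator := assocIso
  leftUnitor := leftUnitorIso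
  rightUnitor := rightUnitorIso
  whiskerLeft_id := whiskerL_id
  whiskerLeft_comp M _ _ _ f g := whiskerL_comp M f g
  id_whiskerLeft f := by
    rw [← Category.assoc, Iso.eq_comp_inv]; exact leftUnitor_nat f
  comp_whiskerLeft M N _ _ f := by
    rw [← Category.assoc, Iso.eq_comp_inv]; exact assoc_nat₃ M N f
  id_whiskerRight := id_whiskerR
  comp_whiskerRight f g N := comp_whiskerR f g N
  whiskerRight_id f := by
    rw [← Category.assoc, Iso.eq_comp_inv]; exact rightUnitor_nat f
  whiskerRight_comp f N P := by
    rw [Iso.eq_inv_comp]; exact (assoc_nat₁ f N P).symm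
  whisker_assoc M _ _ f P := by
    rw [← Category.assoc, Iso.eq_comp_inv]; exact assoc_nat₂ M f P
  whisker_exchange f g := whisker_exch f g
  pentagon := Bicomod.pentagon
  triangle := Bicomod.triangle

/-- The comodule underlying a 1-cell. -/
abbrev bicomod {A B : Comod V} (M : A ⟶ B) : Bicomod A.comon B.comon := M

/-- The map in `V` underlying a 2-cell. -/
abbrev map {A B : Comod V} {M N : A ⟶ B} (f : M ⟶ N) : (bicomod M).X ⟶ (bicomod N).X :=
  Bicomod.Hom.hom f

section

variable {A B C D : Comod V}

lemma map_comp {M N P : A ⟶ B} (f : M ⟶ N) (g : N ⟶ P) : map (f ≫ g) = map f ≫ map g := rfl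

lemma map_id (M : A ⟶ B) : map (𝟙 M) = 𝟙 (bicomod M).X := rfl

lemma map_ext {M N : A ⟶ B} {f g : M ⟶ N} (h : map f = map g) : f = g := Bicomod.hom_ext h

lemma map_whiskerLeft (M : A ⟶ B) {N N' : B ⟶ C} (g : N ⟶ N') :
    map (Bicategory.whiskerLeft M g) ≫ ι (bicomod M) (bicomod N') =
      ι (bicomod M) (bicomod N) ≫ (bicomod M).X ◁ map g :=
  whiskerL_ι _ _

lemma map_whiskerLeft_assoc : type_of% (reassoc_of% @map_whiskerLeft) :=
  @(reassoc_of% @map_whiskerLeft)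

lemma map_whiskerRight {M M' : A ⟶ B} (f : M ⟶ M') (N : B ⟶ C) :
    map (Bicategory.whiskerRight f N) ≫ ι (bicomod M') (bicomod N) =
      ι (bicomod M) (bicomod N) ≫ map f ▷ (bicomod N).X :=
  whiskerR_ι _ _

lemma map_whiskerRight_assoc : type_of% (reassoc_of% @map_whiskerRight) :=
  @(reassoc_of% @map_whiskerRight)

lemma map_associator (M : A ⟶ B) (N : B ⟶ C) (P : C ⟶ D) :
    map (Bicategory.associator M N P).hom ≫ ι (bicomod M) (bicomod (N ≫ P)) ≫
        (bicomod M).X ◁ ι (bicomod N) (bicomod P) =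
      ι (bicomod (M ≫ N)) (bicomod P) ≫ ι (bicomod M) (bicomod N) ▷ (bicomod P).X ≫
        (α_ _ _ _).hom :=
  assocIso_hom_ι _ _ _



lemma map_leftUnitor_inv (M : A ⟶ B) :
    map (Bicategory.leftUnitor M).inv ≫ ι (regular A.comon) (bicomod M) = (bicomod M).coactL :=
  lift_ι _ _

lemma map_rightUnitor_inv (M : A ⟶ B) :
    map (Bicategory.rightUnitor M).inv ≫ ι (bicomod M) (regular B.comon) = (bicomod M).coactR :=
  lift_ι _ _

end

section

variable {G E : Comon V}

lemma comul_left (f : G ⟶ E) : f.hom ≫ Δ[E.X] = Δ[G.X] ≫ G.X ◁ f.hom ≫ f.hom ▷ E.X := by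
  simp [tensorHom_def']



lemma comul_right (f : G ⟶ E) : f.hom ≫ Δ[E.X] = Δ[G.X] ≫ f.hom ▷ G.X ≫ E.X ◁ f.hom := by
  rw [IsComonHom.hom_comul, MonoidalCategory.tensorHom_def]



/-- The comodule `f_*` from `G` to `E` given by a comonoid map `f : G ⟶ E`. -/
@[simps]
def lower (f : G ⟶ E) : Bicomod G E where
  X := G.X
  coactL := Δ[G.X]
  coactR := Δ[G.X] ≫ G.X ◁ f.hom
  coactL_counit := by simp
  coactL_coassoc := by simp
  coactR_counit := by simp [← whiskerLeft_comp]
  coactR_coassoc := by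
    have h : G.X ◁ f.hom ≫ G.X ◁ Δ[E.X] = G.X ◁ Δ[G.X] ≫ G.X ◁ G.X ◁ f.hom ≫
        G.X ◁ f.hom ▷ E.X := by
      simp only [← whiskerLeft_comp, comul_left]
    have h' := ComonObj.comul_assoc G.X
    simp only [Category.assoc, comp_whiskerRight, reassoc_of% h, reassoc_of% h']
    rw [whisker_exchange_assoc]
    simp
  coact_comm := by
    have h' := ComonObj.comul_assoc G.X
    simp only [Category.assoc, whiskerLeft_comp, reassoc_of% h']
    rw [whisker_exchange_assoc]
    simp

/-- The comodule `f^*` from `E` to `G` given by a comonoid map `f : G ⟶ E`. -/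
@[simps]
def upper (f : G ⟶ E) : Bicomod E G where
  X := G.X
  coactL := Δ[G.X] ≫ f.hom ▷ G.X
  coactR := Δ[G.X]
  coactL_counit := by simp [← comp_whiskerRight]
  coactL_coassoc := by
    have h : f.hom ▷ G.X ≫ Δ[E.X] ▷ G.X = Δ[G.X] ▷ G.X ≫ f.hom ▷ G.X ▷ G.X ≫
        (E.X ◁ f.hom) ▷ G.X := by
      simp only [← comp_whiskerRight, comul_right]
    have h' := ComonObj.comul_assoc G.X
    simp only [Category.assoc, whiskerLeft_comp, reassoc_of% h]
    rw [← whisker_exchange_assoc, reassoc_of% h']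
    simp
  coactR_counit := by simp
  coactR_coassoc := by simp
  coact_comm := by
    have h' := ComonObj.comul_assoc G.X
    simp only [Category.assoc, comp_whiskerRight]
    rw [← whisker_exchange, reassoc_of% h']
    simp

/-- `f_*` as a 1-cell of the bicategory of comodules. -/
def star (f : G ⟶ E) : (⟨G⟩ : Comod V) ⟶ ⟨E⟩ := lower f

/-- `f^*` as a 1-cell of the bicategory of comodules. -/
def costar (f : G ⟶ E) : (⟨E⟩ : Comod V) ⟶ ⟨G⟩ := upper f

end

section Comonads

variable {E : Comod V} (t : E ⟶ E) [Bicategory.Comonad t]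

/-- The comultiplication `G ⟶ G ⊗_E G ⟶ G ⊗ G` in `V` given by a comonad `G` on `E`. -/
noncomputable def totalComul : (bicomod t).X ⟶ (bicomod t).X ⊗ (bicomod t).X :=
  map (Bicategory.Comonad.comul (t := t)) ≫ ι (bicomod t) (bicomod t)

/-- The counit map `G ⟶ E` of a comonad `G` on `E`. -/
noncomputable def totalMap : (bicomod t).X ⟶ E.comon.X :=
  map (Bicategory.Comonad.counit (t := t))

lemma totalComul_totalMap_right :
    totalComul t ≫ (bicomod t).X ◁ totalMap t = (bicomod t).coactR := by
  have h := congrArg map (Bicategory.Comonad.comul_counit t)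
  rw [← map_rightUnitor_inv, ← h, map_comp, totalComul, Category.assoc, Category.assoc]
  exact (congrArg _ (map_whiskerLeft t (Bicategory.Comonad.counit (t := t))).symm)

lemma totalComul_totalMap_right_assoc : type_of% (reassoc_of% @totalComul_totalMap_right) :=
  @(reassoc_of% @totalComul_totalMap_right)

lemma totalComul_totalMap_left :
    totalComul t ≫ totalMap t ▷ (bicomod t).X = (bicomod t).coactL := by
  have h := congrArg map (Bicategory.Comonad.counit_comul t)
  rw [← map_leftUnitor_inv, ← h, map_comp, totalComul, Category.assoc, Category.assoc]
  exact (congrArg _ (map_whiskerRight (Bicategory.Comonad.counit (t := t)) t).symm)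

lemma totalComul_totalMap_left_assoc : type_of% (reassoc_of% @totalComul_totalMap_left) :=
  @(reassoc_of% @totalComul_totalMap_left)

lemma totalComul_assoc :
    totalComul t ≫ (bicomod t).X ◁ totalComul t =
      totalComul t ≫ totalComul t ▷ (bicomod t).X ≫ (α_ _ _ _).hom := by
  have h := congrArg (fun x => map x ≫ ι (bicomod t) (bicomod (t ≫ t)) ≫
    (bicomod t).X ◁ ι (bicomod t) (bicomod t)) (Bicategory.Comonad.comul_assoc t)
  simp only [map_comp, Category.assoc, map_associator, map_whiskerLeft_assoc] at h
  erw [map_whiskerRight_assoc] at h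
  simp only [totalComul, Category.assoc, whiskerLeft_comp, comp_whiskerRight]
  exact h

/-- The comonoid in `V` given by a comonad `G` on `E`: its comultiplication is
`G ⟶ G ⊗_E G ⟶ G ⊗ G` and its counit is `G ⟶ E ⟶ I`. -/
@[simps]
noncomputable def total : Comon V where
  X := (bicomod t).X
  comon :=
    { comul := totalComul t
      counit := totalMap t ≫ ε[E.comon.X]
      counit_comul := by
        rw [comp_whiskerRight, totalComul_totalMap_left_assoc, coactL_counit]
      comul_counit := by
        rw [whiskerLeft_comp, totalComul_totalMap_right_assoc, coactR_counit]
      comul_assoc := totalComul_assoc t }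

lemma totalMap_comul :
    totalMap t ≫ Δ[E.comon.X] = totalComul t ≫ (totalMap t ⊗ₘ totalMap t) := by
  have h := (Bicategory.Comonad.counit (t := t)).hom_coactL
  rw [MonoidalCategory.tensorHom_def, totalComul_totalMap_left_assoc]
  exact h

lemma map_totalMap {t t' : E ⟶ E} [Bicategory.Comonad t] [Bicategory.Comonad t'] (g : t ⟶ t')
    [IsComonHom g] : map g ≫ totalMap t' = totalMap t :=
  congrArg map (IsComonHom.hom_counit g)

lemma map_totalComul {t t' : E ⟶ E} [Bicategory.Comonad t] [Bicategory.Comonad t'] (g : t ⟶ t')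
    [IsComonHom g] : map g ≫ totalComul t' = totalComul t ≫ (map g ⊗ₘ map g) := by
  have h := congrArg (fun x => map x ≫ ι (bicomod t') (bicomod t')) (IsComonHom.hom_comul g)
  rw [tensorHom_def] at h
  rw [MonoidalCategory.tensorHom_def]
  simp only [map_comp, Category.assoc] at h
  simp only [totalComul, Category.assoc]
  refine h.trans (congrArg _ ?_)
  erw [map_whiskerLeft, map_whiskerRight_assoc]

/-- The counit `G ⟶ E` of a comonad `G` on `E` is a comonoid map. -/
@[simps]
noncomputable def totalHom : total t ⟶ E.comon where
  hom := totalMap t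
  isComonHom_hom :=
    { hom_counit := rfl
      hom_comul := totalMap_comul t }

open Bicategory.OplaxTrans.ComonadBicat

lemma totalComul_condition :
    totalComul t ≫ (bicomod t).coactR ▷ (bicomod t).X ≫ (α_ _ _ _).hom =
      totalComul t ≫ (bicomod t).X ◁ (bicomod t).coactL := by
  rw [totalComul, Category.assoc, Category.assoc, ι_condition]

lemma totalComul_coactR :
    totalComul t ≫ (bicomod t).X ◁ (bicomod t).coactR ≫ (α_ _ _ _).inv =
      (bicomod t).coactR ≫ totalComul t ▷ E.comon.X := by
  have h := (Bicategory.Comonad.comul (t := t)).hom_coactR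
  have h' := coactR_ι (bicomod t) (bicomod t)
  rw [totalComul, Category.assoc, ← h', comp_whiskerRight]
  exact (Category.assoc _ _ _).symm.trans
    ((congrArg (· ≫ ι (bicomod t) (bicomod t) ▷ E.comon.X) h).trans (Category.assoc _ _ _))

/-- The coaction `δ : ε_* ⟶ ε_* ⊗_E G` of a comonad `G` on `E` on the comodule `ε_*` from `G` to
`E`, where `ε : G ⟶ E` is the counit. -/
noncomputable def universalCoaction :
    Bicomod.Hom (lower (totalHom t)) (tensor (lower (totalHom t)) (bicomod t)) :=
  have e : (lower (totalHom t)).coactR = (bicomod t).coactR := totalComul_totalMap_right t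
  homLift (T := lower (totalHom t)) (M := lower (totalHom t)) (totalComul t)
    (by rw [e]; exact totalComul_condition t)
    (totalComul_assoc t).symm
    (by rw [e]; exact totalComul_coactR t)

lemma universalCoaction_ι :
    map (M := star (totalHom t)) (N := star (totalHom t) ≫ t) (universalCoaction t) ≫
      ι (bicomod (star (totalHom t))) (bicomod t) = totalComul t :=
  lift_ι _ _

lemma coaction_counit {A : Comod V} {k : A ⟶ E} (γ : k ⟶ k ≫ t)
    (h : (map γ ≫ ι (bicomod k) (bicomod t)) ≫ (bicomod k).X ◁ totalMap t = (bicomod k).coactR) :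
    γ ≫ Bicategory.whiskerLeft k Bicategory.Comonad.counit = (Bicategory.rightUnitor k).inv := by
  apply tensor_hom_ext
  have h₁ := map_whiskerLeft k (Bicategory.Comonad.counit (t := t))
  have h₂ := map_rightUnitor_inv k
  refine Eq.trans ?_ h₂.symm
  rw [← h, Category.assoc]
  exact (Category.assoc _ _ _).trans (congrArg _ h₁)

lemma coaction_comul {A : Comod V} {k : A ⟶ E} (γ : k ⟶ k ≫ t)
    (h : (map γ ≫ ι (bicomod k) (bicomod t)) ≫ (bicomod k).X ◁ totalComul t =
      (map γ ≫ ι (bicomod k) (bicomod t)) ≫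
        (map γ ≫ ι (bicomod k) (bicomod t)) ▷ (bicomod t).X ≫ (α_ _ _ _).hom) :
    γ ≫ Bicategory.whiskerLeft k Bicategory.Comonad.comul =
      γ ≫ Bicategory.whiskerRight γ t ≫ (Bicategory.associator k t t).hom := by
  apply tensor_hom_ext₃
  change map (γ ≫ Bicategory.whiskerLeft k Bicategory.Comonad.comul) ≫
      ι (bicomod k) (bicomod (t ≫ t)) ≫ (bicomod k).X ◁ ι (bicomod t) (bicomod t) =
    map (γ ≫ Bicategory.whiskerRight γ t ≫ (Bicategory.associator k t t).hom) ≫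
      ι (bicomod k) (bicomod (t ≫ t)) ≫ (bicomod k).X ◁ ι (bicomod t) (bicomod t)
  simp only [map_comp, Category.assoc, map_associator, map_whiskerLeft_assoc]
  simp only [totalComul, Category.assoc, whiskerLeft_comp, comp_whiskerRight] at h
  rw [map_whiskerRight_assoc]
  exact h

/-- The coalgebra `(ε_*, δ)` of a comonad `G` on `E`, from the comonoid `G` to `E`. -/
noncomputable def universalCoalgebra :
    (Bicategory.comonadInclusion (Comod V)).obj ⟨total t⟩ ⟶ mkOfComonad t :=
  Bicategory.coalgebra (x := (⟨total t⟩ : Comod V)) (star (totalHom t)) (universalCoaction t)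
    (coaction_counit t _ (by
      rw [universalCoaction_ι]
      rfl))
    (coaction_comul t _ (by
      rw [universalCoaction_ι]
      exact totalComul_assoc t))

end Comonads

variable (E : Comon V)

/-- The functor from comonads on `E` in the bicategory of comodules to comonoid maps with
codomain `E`, sending a comonad `G` to the comonoid `G` with the counit `G ⟶ E`. -/
noncomputable def comonadToOver :
    Comon ((⟨E⟩ : Comod V) ⟶ (⟨E⟩ : Comod V)) ⥤ Over E where
  obj G := Over.mk (totalHom G.X)
  map {G H} g := Over.homMk
    { hom := map g.hom
      isComonHom_hom :=
        { hom_counit := by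
            have h := map_totalMap g.hom
            exact (Category.assoc _ _ _).symm.trans (congrArg (· ≫ ε[E.X]) h)
          hom_comul := map_totalComul g.hom } }
    (by
      ext
      exact congrArg map (IsComonHom.hom_counit g.hom))
  map_id G := by
    ext
    rfl
  map_comp f g := by
    ext
    rfl

end Comod
end CategoryTheory

open CategoryTheory MonoidalCategory Limits ComonObj

/-!
Everything rests on one isomorphism. For a comonoid map `f : G ⟶ E` and a comodule `M` from `A`
to `G`, the equalizer `M ⊗_G f_*` has the same underlying object as `M ⊗_G G`, so the coaction
`M ⟶ M ⊗ G` identifies it with `M`, with right coaction corestricted along `f`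
(`Bicomod.corestrictIso`).

*Coalgebras.* Let `G` be a comonad on `E`. A coalgebra `k ⟶ k ⊗_E G` with domain `X`, followed by
the inclusion in `k ⊗ G`, is a coaction of the comonoid `G` on `k` which commutes with the left
`X`-coaction and which gives back the right `E`-coaction of `k` on composition with `ε : G ⟶ E`.
So `G`-coalgebras with domain `X` are comodules from `X` to `G` (`Comod.ofCoalgebra`). Composition
with `(ε_*, δ)` sends a comodule `M` to `M ⊗_G ε_* ≅ M` with precisely the coaction of `G` on `M`
(`Comod.totalCoact_compUniversal`), so it is an equivalence (`Comod.isUniversalCoalgebra`).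

*Comonads over `E`.* The two coactions of `E` on a comonad `G` are its comultiplication in `V`
followed by `ε` on one of the factors, so maps of comonads are the maps of comonoids over `E`
(`Comod.full_comonadToOver`). For a comonoid map `f : G ⟶ E`, the unit `Δ` and the counit `f` satisfy
the triangle identities for `f_* ⊣ f^*` by the counit laws of `G` (`Comod.starAdjunction`), and the
isomorphism `f^* ⊗_G f_* ≅ G` identifies the comonoid of the induced comonad with `G`
(`Comod.inducedComonadIso`). Hence every comonoid over `E` comes from a comonad.

*The right biadjoint.* Every object of the bicategory of comonads is a comonad `(E, G)`
(`Bicategory.exists_eq_mkOfComonad`), so it has a universal coalgebra. For any pseudofunctor `F`, a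
choice of 1-cells `u_c : F (R c) ⟶ c` composition with which gives equivalences makes `R` a right
biadjoint of `F` (`Bicategory.UniversalArrows.rightBiadjoint`): since the functors `F (-) ≫ u_c` are
faithful, the coherence of `R` may be checked after applying them, where it becomes the coherence
of pasting of 2-cells.
-/

namespace CategoryTheory

/-! ### Right biadjoints from universal arrows -/

namespace Bicategory

universe w₁ w₂ v₁ v₂ u₁ u₂

-- The names for whiskerings, associators and unitors also denote those of a monoidal category.
local infixr:81 (priority := high) " ◁ " => Bicategory.whiskerLeft
local infixl:81 (priority := high) " ▷ " => Bicategory.whiskerRight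
local infixr:80 (priority := high) " ⊗≫ " => bicategoricalComp
local notation (priority := high) "α_" => Bicategory.associator
local notation (priority := high) "λ_" => Bicategory.leftUnitor
local notation (priority := high) "ρ_" => Bicategory.rightUnitor

namespace UniversalArrows

variable {B : Type u₁} [Bicategory.{w₁, v₁} B] {C : Type u₂} [Bicategory.{w₂, v₂} C]
  (F : B ⥤ᵖ C) {R : C → B} (u : ∀ c, F.obj (R c) ⟶ c)

/-- The pasting of a 2-cell `φ : F a ≫ u_c ⟶ k` with a 2-cell `ψ : F b ≫ u_d ⟶ u_c ≫ g`. -/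
def paste {x : B} {c d : C} {a : x ⟶ R c} {b : R c ⟶ R d} {k : F.obj x ⟶ c} {g : c ⟶ d}
    (φ : F.map a ≫ u c ⟶ k) (ψ : F.map b ≫ u d ⟶ u c ≫ g) : F.map (a ≫ b) ≫ u d ⟶ k ≫ g :=
  (F.mapComp a b).hom ▷ u d ≫ (α_ _ _ _).hom ≫ F.map a ◁ ψ ≫ (α_ _ _ _).inv ≫ φ ▷ g

variable {x : B} {c d e : C} {a a' : x ⟶ R c} {b b' : R c ⟶ R d} {k k' : F.obj x ⟶ c}
  {g g' : c ⟶ d}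

lemma whiskerRight_paste (β : a ⟶ a') (φ : F.map a' ≫ u c ⟶ k) (ψ : F.map b ≫ u d ⟶ u c ≫ g) :
    F.map₂ (β ▷ b) ▷ u d ≫ paste F u φ ψ = paste F u (F.map₂ β ▷ u c ≫ φ) ψ := by
  simp only [paste, Pseudofunctor.map₂_whisker_right, comp_whiskerRight, Category.assoc]
  rw [← comp_whiskerRight_assoc (F.mapComp a' b).inv, Iso.inv_hom_id, id_whiskerRight,
    Category.id_comp]
  calc _ = (F.mapComp a b).hom ▷ u d ⊗≫
        (F.map₂ β ▷ (F.map b ≫ u d) ≫ F.map a' ◁ ψ) ⊗≫ φ ▷ g := by bicategory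
    _ = _ := by rw [← whisker_exchange]; bicategory

lemma whiskerRight_paste_assoc : type_of% (reassoc_of% @whiskerRight_paste) :=
  @(reassoc_of% @whiskerRight_paste)

lemma whiskerLeft_paste (β : b ⟶ b') (φ : F.map a ≫ u c ⟶ k) (ψ : F.map b' ≫ u d ⟶ u c ≫ g) :
    F.map₂ (a ◁ β) ▷ u d ≫ paste F u φ ψ = paste F u φ (F.map₂ β ▷ u d ≫ ψ) := by
  simp only [paste, Pseudofunctor.map₂_whisker_left, comp_whiskerRight, Category.assoc]
  rw [← comp_whiskerRight_assoc (F.mapComp a b').inv]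
  simp

lemma paste_whiskerLeft (φ : F.map a ≫ u c ⟶ k) (ψ : F.map b ≫ u d ⟶ u c ≫ g) (η : g ⟶ g') :
    paste F u φ (ψ ≫ u c ◁ η) = paste F u φ ψ ≫ k ◁ η := by
  simp [paste, ← whisker_exchange]

lemma paste_whiskerRight (φ : F.map a ≫ u c ⟶ k) (ψ : F.map b ≫ u d ⟶ u c ≫ g) (η : k ⟶ k') :
    paste F u (φ ≫ η) ψ = paste F u φ ψ ≫ η ▷ g := by
  simp [paste]

lemma paste_assoc {b₂ : R d ⟶ R e} {h : d ⟶ e} (φ : F.map a ≫ u c ⟶ k)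
    (ψ : F.map b ≫ u d ⟶ u c ≫ g) (χ : F.map b₂ ≫ u e ⟶ u d ≫ h) :
    F.map₂ (α_ a b b₂).hom ▷ u e ≫ paste F u φ (paste F u ψ χ ≫ (α_ _ _ _).hom) =
      paste F u (paste F u φ ψ) χ ≫ (α_ _ _ _).hom := by
  have h₁ : F.map a ◁ (F.mapComp b b₂).inv ▷ u e ≫ F.map a ◁ (F.mapComp b b₂).hom ▷ u e =
      𝟙 _ := by
    rw [← whiskerLeft_comp, ← comp_whiskerRight]; simp
  simp only [paste, Pseudofunctor.map₂_associator, comp_whiskerRight, Category.assoc,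
    whiskerLeft_comp]
  rw [← comp_whiskerRight_assoc (F.mapComp a (b ≫ b₂)).inv, Iso.inv_hom_id, id_whiskerRight,
    Category.id_comp, whisker_assoc_assoc, Iso.inv_hom_id_assoc, reassoc_of% h₁]
  calc _ = (F.mapComp (a ≫ b) b₂).hom ▷ u e ⊗≫
        ((F.mapComp a b).hom ▷ (F.map b₂ ≫ u e) ≫ (F.map a ≫ F.map b) ◁ χ) ⊗≫
        F.map a ◁ ψ ▷ h ⊗≫ φ ▷ g ▷ h ⊗≫ 𝟙 _ := by bicategory
    _ = _ := by rw [← whisker_exchange]; bicategory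

lemma id_paste (ψ : F.map b ≫ u d ⟶ u c ≫ g) :
    paste F u ((F.mapId (R c)).hom ▷ u c ≫ (λ_ (u c)).hom) ψ = F.map₂ (λ_ b).hom ▷ u d ≫ ψ := by
  simp only [paste, Pseudofunctor.map₂_left_unitor, comp_whiskerRight, Category.assoc]
  calc _ = (F.mapComp (𝟙 (R c)) b).hom ▷ u d ⊗≫
        (F.map (𝟙 (R c)) ◁ ψ ≫ (F.mapId (R c)).hom ▷ (u c ≫ g)) ⊗≫ 𝟙 _ := by bicategory
    _ = _ := by rw [whisker_exchange]; bicategory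

lemma paste_id (φ : F.map a ≫ u c ⟶ k) :
    paste F u φ ((F.mapId (R c)).hom ▷ u c ≫ (λ_ (u c)).hom ≫ (ρ_ (u c)).inv) =
      F.map₂ (ρ_ a).hom ▷ u c ≫ φ ≫ (ρ_ k).inv := by
  simp only [paste, Pseudofunctor.map₂_right_unitor, comp_whiskerRight, Category.assoc]
  bicategory

instance isIso_paste (φ : F.map a ≫ u c ⟶ k) (ψ : F.map b ≫ u d ⟶ u c ≫ g) [IsIso φ] [IsIso ψ] :
    IsIso (paste F u φ ψ) := by
  unfold paste; infer_instance

variable [hu : ∀ x c, (postcompAfter F x (u c)).IsEquivalence]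

include hu in
/-- 2-cells into `R c` may be compared after applying `F (-) ▷ u_c` and composing with an
invertible 2-cell. -/
lemma hom_ext {f f' : x ⟶ R c} {α β : f ⟶ f'} (ψ : F.map f' ≫ u c ⟶ k) [IsIso ψ]
    (h : F.map₂ α ▷ u c ≫ ψ = F.map₂ β ▷ u c ≫ ψ) : α = β :=
  (postcompAfter F x (u c)).map_injective ((cancel_mono ψ).1 h)

/-- The 1-cell `R c ⟶ R d` induced by a 1-cell `c ⟶ d`. -/
noncomputable def map (f : c ⟶ d) : R c ⟶ R d :=
  (postcompAfter F (R c) (u d)).objPreimage (u c ≫ f)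

/-- The isomorphism which determines the 1-cell `R c ⟶ R d` induced by a 1-cell `c ⟶ d`. -/
noncomputable def mapIso (f : c ⟶ d) : F.map (map F u f) ≫ u d ≅ u c ≫ f :=
  (postcompAfter F (R c) (u d)).objObjPreimageIso (u c ≫ f)

/-- An invertible 2-cell `f ⟶ f'` from an invertible 2-cell between the images of `f` and `f'`. -/
noncomputable def preimageIso {f f' : x ⟶ R c} (i : F.map f ≫ u c ≅ F.map f' ≫ u c) : f ≅ f' :=
  (postcompAfter F x (u c)).preimageIso i

lemma map₂_preimageIso {f f' : x ⟶ R c} (i : F.map f ≫ u c ≅ F.map f' ≫ u c) :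
    F.map₂ (preimageIso F u i).hom ▷ u c = i.hom :=
  (postcompAfter F x (u c)).map_preimage i.hom

/-- The 2-cell between induced 1-cells which corresponds to a 2-cell `f ⟶ g`. -/
noncomputable def map₂ {f g : c ⟶ d} (η : f ⟶ g) : map F u f ⟶ map F u g :=
  (postcompAfter F (R c) (u d)).preimage ((mapIso F u f).hom ≫ u c ◁ η ≫ (mapIso F u g).inv)

/-- The isomorphisms `mapIso` are natural; this characterizes `map₂`. -/
lemma map₂_mapIso {f g : c ⟶ d} (η : f ⟶ g) :
    F.map₂ (map₂ F u η) ▷ u d ≫ (mapIso F u g).hom = (mapIso F u f).hom ≫ u c ◁ η := by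
  have h : F.map₂ (map₂ F u η) ▷ u d = (mapIso F u f).hom ≫ u c ◁ η ≫ (mapIso F u g).inv :=
    (postcompAfter F (R c) (u d)).map_preimage _
  simp [h]

lemma map₂_mapIso_assoc : type_of% (reassoc_of% @map₂_mapIso) :=
  @(reassoc_of% @map₂_mapIso)

/-- The 1-cell induced by an identity is isomorphic to the identity. -/
noncomputable def mapId (c : C) : map F u (𝟙 c) ≅ 𝟙 (R c) :=
  preimageIso F u (mapIso F u (𝟙 c) ≪≫ ρ_ (u c) ≪≫ (λ_ (u c)).symm ≪≫
    whiskerRightIso (F.mapId (R c)).symm (u c))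

lemma map₂_mapId (c : C) :
    F.map₂ (mapId F u c).hom ▷ u c ≫ (F.mapId (R c)).hom ▷ u c ≫ (λ_ (u c)).hom =
      (mapIso F u (𝟙 c)).hom ≫ (ρ_ (u c)).hom := by
  rw [mapId, map₂_preimageIso]
  simp [← comp_whiskerRight_assoc]

lemma map₂_mapId_right (c : C) :
    F.map₂ (mapId F u c).hom ▷ u c ≫ (F.mapId (R c)).hom ▷ u c ≫ (λ_ (u c)).hom ≫ (ρ_ (u c)).inv =
      (mapIso F u (𝟙 c)).hom := by
  rw [← cancel_mono (ρ_ (u c)).hom]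
  simpa using map₂_mapId F u c

/-- The 1-cell induced by a composite is isomorphic to the composite of the induced 1-cells. -/
noncomputable def mapComp (f : c ⟶ d) (g : d ⟶ e) :
    map F u (f ≫ g) ≅ map F u f ≫ map F u g :=
  preimageIso F u (mapIso F u (f ≫ g) ≪≫ (α_ _ _ _).symm ≪≫
    (asIso (paste F u (mapIso F u f).hom (mapIso F u g).hom)).symm)

/-- The isomorphism `mapIso` of a composite is the pasting of those of the factors; this
characterizes `mapComp`. -/
lemma map₂_mapComp (f : c ⟶ d) (g : d ⟶ e) :
    F.map₂ (mapComp F u f g).hom ▷ u e ≫ paste F u (mapIso F u f).hom (mapIso F u g).hom =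
      (mapIso F u (f ≫ g)).hom ≫ (α_ _ _ _).inv := by
  rw [mapComp, map₂_preimageIso]
  simp

lemma map₂_mapComp_assoc : type_of% (reassoc_of% @map₂_mapComp) :=
  @(reassoc_of% @map₂_mapComp)

/-- Universal arrows `u_c : F (R c) ⟶ c` make `R` a pseudofunctor. -/
noncomputable def right : C ⥤ᵖ B where
  obj := R
  map := map F u
  map₂ := map₂ F u
  map₂_id f := hom_ext F u (mapIso F u f).hom (by simp [map₂_mapIso])
  map₂_comp {_ _ _ _ h} η θ := hom_ext F u (mapIso F u h).hom (by
    simp [map₂_mapIso, map₂_mapIso_assoc])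
  mapId := mapId F u
  mapComp := mapComp F u
  map₂_whisker_left f g h η := by
    rw [← Category.assoc, Iso.eq_comp_inv]
    apply hom_ext F u (paste F u (mapIso F u f).hom (mapIso F u h).hom)
    simp only [PrelaxFunctor.map₂_comp, comp_whiskerRight, Category.assoc, map₂_mapComp,
      whiskerLeft_paste, map₂_mapIso, map₂_mapIso_assoc, paste_whiskerLeft, map₂_mapComp_assoc]
    simp
  map₂_whisker_right {_ _ _ f g} η h := by
    rw [← Category.assoc, Iso.eq_comp_inv]
    apply hom_ext F u (paste F u (mapIso F u g).hom (mapIso F u h).hom)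
    simp only [PrelaxFunctor.map₂_comp, comp_whiskerRight, Category.assoc, map₂_mapComp,
      whiskerRight_paste, map₂_mapIso, map₂_mapIso_assoc, paste_whiskerRight, map₂_mapComp_assoc]
    simp
  map₂_associator f g h := by
    simp only [← Category.assoc]
    rw [Iso.eq_comp_inv, ← whiskerLeftIso_inv, Iso.eq_comp_inv]
    apply hom_ext F u (paste F u (mapIso F u f).hom
      (paste F u (mapIso F u g).hom (mapIso F u h).hom ≫ (α_ _ _ _).hom))
    simp only [PrelaxFunctor.map₂_comp, comp_whiskerRight, Category.assoc, whiskerLeftIso_hom,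
      whiskerLeft_paste, map₂_mapComp_assoc, Iso.inv_hom_id, Category.comp_id, map₂_mapComp,
      map₂_mapIso_assoc, paste_assoc, whiskerRight_paste_assoc, paste_whiskerRight]
    simp
  map₂_left_unitor {c d} f := by
    apply hom_ext F u (mapIso F u f).hom
    simp only [PrelaxFunctor.map₂_comp, comp_whiskerRight, Category.assoc, ← id_paste,
      whiskerRight_paste, map₂_mapIso, map₂_mapId]
    simp only [paste_whiskerRight, map₂_mapComp_assoc]
    simp
  map₂_right_unitor f := by
    apply hom_ext F u ((mapIso F u f).hom ≫ (ρ_ _).inv)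
    simp only [PrelaxFunctor.map₂_comp, comp_whiskerRight, Category.assoc, ← paste_id,
      whiskerLeft_paste, map₂_mapIso_assoc, map₂_mapId_right, map₂_mapComp]
    simp

/-- A pseudofunctor with a universal arrow to every object has a right biadjoint. -/
noncomputable def rightBiadjoint : RightBiadjoint F where
  right := right F u
  counit :=
    { app := u
      naturality := mapIso F u
      naturality_naturality := map₂_mapIso F u
      naturality_id c := by
        change (mapIso F u (𝟙 c)).hom ≫ u c ◁ 𝟙 (𝟙 c) =
          (F.map₂ (mapId F u c).hom ≫ (F.mapId _).hom) ▷ u c ≫ (λ_ (u c)).hom ≫ (ρ_ (u c)).inv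
        simp [← map₂_mapId_right]
      naturality_comp {c d e} f g := by
        change (mapIso F u (f ≫ g)).hom ≫ u c ◁ 𝟙 (f ≫ g) =
          (F.map₂ (mapComp F u f g).hom ≫ (F.mapComp _ _).hom) ▷ u e ≫ (α_ _ _ _).hom ≫
            F.map (map F u f) ◁ (mapIso F u g).hom ≫ (α_ _ _ _).inv ≫
            (mapIso F u f).hom ▷ g ≫ (α_ _ _ _).hom
        rw [← cancel_mono (α_ _ _ _).inv]
        simpa [paste] using (map₂_mapComp F u f g).symm }
  isEquivalence := hu

end UniversalArrows

end Bicategory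

open MonoidalCategory Limits ComonObj

/-! ### Corestriction of comodules and tensoring with `f_*` -/

namespace Bicomod

variable {V : Type u} [Category.{v} V] [MonoidalCategory V]

/-- The corestriction of a comodule from `A` to `G` along a comonoid map `f : G ⟶ E`. -/
@[simps]
def corestrict {A G E : Comon V} (M : Bicomod A G) (f : G ⟶ E) : Bicomod A E where
  X := M.X
  coactL := M.coactL
  coactR := M.coactR ≫ M.X ◁ f.hom
  coactL_counit := by simp
  coactL_coassoc := M.coactL_coassoc
  coactR_counit := by simp [← whiskerLeft_comp]
  coactR_coassoc := by
    have h : M.X ◁ f.hom ≫ M.X ◁ Δ[E.X] = M.X ◁ Δ[G.X] ≫ M.X ◁ (G.X ◁ f.hom ≫ f.hom ▷ E.X) := by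
      simp only [← whiskerLeft_comp, IsComonHom.hom_comul, tensorHom_def']
    have h' := M.coactR_coassoc
    simp only [Category.assoc, comp_whiskerRight, reassoc_of% h]
    rw [whisker_exchange_assoc, reassoc_of% h']
    simp
  coact_comm := by
    have h' := M.coact_comm
    simp only [Category.assoc, whiskerLeft_comp, reassoc_of% h']
    rw [whisker_exchange_assoc]
    simp

variable [BraidedCategory V] [HasCoreflexiveEqualizers V] [TensorPreservesCoreflexiveEqualizers V]
  {A G E : Comon V}

section Lower

variable (M : Bicomod A G) (f : G ⟶ E)

/-- The inclusion of `M ⊗_G f_*` in `M ⊗ G`. It is `ι`, with `G.X` in place of `(lower f).X` in its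
type, so that rewriting with lemmas about `G` applies. -/
noncomputable def lowerι : (tensor M (Comod.lower f)).X ⟶ M.X ⊗ G.X := ι M (Comod.lower f)

instance : Mono (lowerι M f) := inferInstanceAs (Mono (ι M (Comod.lower f)))
instance (X : V) : Mono (lowerι M f ▷ X) := inferInstanceAs (Mono (ι M (Comod.lower f) ▷ X))

/-- The map underlying the isomorphism `M ⊗_G f_* ⟶ M`. -/
noncomputable def lowerCounit : (tensor M (Comod.lower f)).X ⟶ M.X :=
  lowerι M f ≫ M.X ◁ ε[G.X] ≫ (ρ_ M.X).hom

/-- The map underlying the isomorphism `M ⟶ M ⊗_G f_*`, given by the coaction. The right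
unitor of `M` applies, since the equalizer depends only on the left coaction of `f_*`, which is that
of `G`. -/
noncomputable def lowerCoact : M.X ⟶ (tensor M (Comod.lower f)).X :=
  (rightUnitorIso M).inv.hom

@[simp]
lemma lowerCoact_ι : lowerCoact M f ≫ lowerι M f = M.coactR :=
  lift_ι _ _

@[simp]
lemma lowerCoact_ι_assoc : type_of% (reassoc_of% @lowerCoact_ι) :=
  @(reassoc_of% @lowerCoact_ι)

@[simp]
lemma lowerCoact_lowerCounit : lowerCoact M f ≫ lowerCounit M f = 𝟙 _ :=
  congrArg Hom.hom (rightUnitorIso M).inv_hom_id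

@[simp]
lemma lowerCoact_lowerCounit_assoc : type_of% (reassoc_of% @lowerCoact_lowerCounit) :=
  @(reassoc_of% @lowerCoact_lowerCounit)

@[simp]
lemma lowerCounit_lowerCoact : lowerCounit M f ≫ lowerCoact M f = 𝟙 _ :=
  congrArg Hom.hom (rightUnitorIso M).hom_inv_id

@[simp]
lemma lowerCounit_lowerCoact_assoc : type_of% (reassoc_of% @lowerCounit_lowerCoact) :=
  @(reassoc_of% @lowerCounit_lowerCoact)

@[simp]
lemma lowerCounit_coactR : lowerCounit M f ≫ M.coactR = lowerι M f := by
  rw [← lowerCoact_ι M f, lowerCounit_lowerCoact_assoc]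

@[simp]
lemma lowerCounit_coactR_assoc : type_of% (reassoc_of% @lowerCounit_coactR) :=
  @(reassoc_of% @lowerCounit_coactR)

lemma lowerCoact_coactL : lowerCoact M f ≫ (tensor M (Comod.lower f)).coactL =
    M.coactL ≫ A.X ◁ lowerCoact M f :=
  (rightUnitorIso M).inv.hom_coactL

lemma lowerCounit_coactL : lowerCounit M f ≫ M.coactL =
    (tensor M (Comod.lower f)).coactL ≫ A.X ◁ lowerCounit M f :=
  (rightUnitorIso M).hom.hom_coactL

/-- Tensoring with `f_*` is corestriction along `f`. -/
noncomputable def corestrictIso : M.corestrict f ≅ tensor M (Comod.lower f) :=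
  isoMk
    { hom := lowerCoact M f
      hom_coactL := lowerCoact_coactL M f
      hom_coactR := by
        rw [← cancel_mono (lowerι M f ▷ E.X)]
        have h := coactR_ι M (Comod.lower f)
        change (tensor M (Comod.lower f)).coactR ≫ lowerι M f ▷ E.X =
          lowerι M f ≫ M.X ◁ (Δ[G.X] ≫ G.X ◁ f.hom) ≫ (α_ M.X G.X E.X).inv at h
        change (lowerCoact M f ≫ (tensor M (Comod.lower f)).coactR) ≫ lowerι M f ▷ E.X =
          ((M.coactR ≫ M.X ◁ f.hom) ≫ lowerCoact M f ▷ E.X) ≫ lowerι M f ▷ E.X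
        have h' := M.coactR_coassoc
        simp only [Category.assoc, ← comp_whiskerRight, lowerCoact_ι, h, lowerCoact_ι_assoc]
        rw [whisker_exchange, reassoc_of% h']
        simp }
    (lowerCounit M f) (lowerCoact_lowerCounit M f) (lowerCounit_lowerCoact M f)

/-- The coaction of `G` on `M ⊗_G f_*`, transported along the isomorphism with `M`. -/
noncomputable def lowerTotalCoact :
    (tensor M (Comod.lower f)).X ⟶ (tensor M (Comod.lower f)).X ⊗ G.X :=
  lowerCounit M f ≫ M.coactR ≫ lowerCoact M f ▷ G.X

lemma lowerTotalCoact_lowerCounit :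
    lowerTotalCoact M f ≫ lowerCounit M f ▷ G.X = lowerCounit M f ≫ M.coactR := by
  simp only [lowerTotalCoact, Category.assoc, ← comp_whiskerRight, lowerCoact_lowerCounit,
    id_whiskerRight, Category.comp_id]

/-- The coaction of `G` on `M ⊗_G f_*` comes from the comultiplication on the second factor of
`M ⊗ G`. -/
lemma lowerTotalCoact_ι :
    lowerTotalCoact M f ≫ lowerι M f ▷ G.X = lowerι M f ≫ M.X ◁ Δ[G.X] ≫ (α_ _ _ _).inv := by
  simp only [lowerTotalCoact, Category.assoc, ← comp_whiskerRight, lowerCoact_ι]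
  rw [M.coactR_coassoc, lowerCounit_coactR_assoc]

variable {M} {M' : Bicomod A G}

lemma lowerCoact_whiskerR (g : M ⟶ M') :
    lowerCoact M f ≫ (whiskerR g (Comod.lower f)).hom = g.hom ≫ lowerCoact M' f := by
  rw [← cancel_mono (lowerι M' f), Category.assoc, Category.assoc, lowerCoact_ι, g.hom_coactR,
    ← lowerCoact_ι M f, Category.assoc]
  exact congrArg _ (whiskerR_ι g (Comod.lower f))

lemma whiskerR_lower_injective {g g' : M ⟶ M'}
    (h : whiskerR g (Comod.lower f) = whiskerR g' (Comod.lower f)) : g = g' := by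
  have e := lowerCoact_whiskerR f g
  rw [h, lowerCoact_whiskerR] at e
  have e' := congrArg (· ≫ lowerCounit M' f) e
  simp only [Category.assoc, lowerCoact_lowerCounit, Category.comp_id] at e'
  exact hom_ext e'.symm

/-- A map `M ⊗_G f_* ⟶ M' ⊗_G f_*` comes from a comodule map `M ⟶ M'` if it respects the coactions
of `G`, and not only those of `E`. -/
lemma exists_whiskerR_lower_eq (τ : tensor M (Comod.lower f) ⟶ tensor M' (Comod.lower f))
    (h : τ.hom ≫ lowerTotalCoact M' f = lowerTotalCoact M f ≫ τ.hom ▷ G.X) :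
    ∃ g : M ⟶ M', whiskerR g (Comod.lower f) = τ := by
  let g : M ⟶ M' := Hom.mk (lowerCoact M f ≫ τ.hom ≫ lowerCounit M' f)
    (by
      rw [Category.assoc, Category.assoc, lowerCounit_coactL, reassoc_of% τ.hom_coactL,
        reassoc_of% lowerCoact_coactL]
      simp)
    (by
      rw [Category.assoc, Category.assoc, ← lowerTotalCoact_lowerCounit, reassoc_of% h,
        lowerTotalCoact]
      simp)
  have e : lowerCoact M f ≫ (whiskerR g (Comod.lower f)).hom = lowerCoact M f ≫ τ.hom := by
    simp [lowerCoact_whiskerR, g]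
  refine ⟨g, hom_ext ?_⟩
  simpa using congrArg (lowerCounit M f ≫ ·) e

end Lower

lemma assocIso_inv_ι {A B C D : Comon V} (M : Bicomod A B) (N : Bicomod B C) (P : Bicomod C D) :
    (assocIso M N P).inv.hom ≫ ι (tensor M N) P ≫ ι M N ▷ P.X =
      ι M (tensor N P) ≫ M.X ◁ ι N P ≫ (α_ _ _ _).inv := by
  have h := assocInv_ι M N P
  rw [← cancel_mono (α_ M.X N.X P.X).hom]
  simp only [Category.assoc, Iso.inv_hom_id, Category.comp_id]
  exact h

/-- The composite `M ⊗ k ⟶ (M ⊗ N') ⊗ (P ⊗ Q)` of `k : N ⟶ N' ⊗ (P ⊗ Q)` and an associator, in terms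
of tensor products in `V`. -/
lemma whiskerL_assocIso_inv_ι {A B C D F : Comon V} {M : Bicomod A B} {N : Bicomod B F}
    {N' : Bicomod B C} {P : Bicomod C D} {Q : Bicomod D F} (k : N ⟶ tensor N' (tensor P Q)) :
    (whiskerL M k ≫ (assocIso M N' (tensor P Q)).inv).hom ≫ ι (tensor M N') (tensor P Q) ≫
        ι M N' ▷ (tensor P Q).X ≫ (M.X ⊗ N'.X) ◁ ι P Q =
      ι M N ≫ M.X ◁ (k.hom ≫ ι N' (tensor P Q) ≫ N'.X ◁ ι P Q) ≫ (α_ _ _ _).inv := by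
  have h := assocIso_inv_ι M N' (tensor P Q)
  rw [comp_hom, Category.assoc, reassoc_of% h, whiskerL_ι_assoc]
  simp

/-- The composite `M ⊗ k ⟶ (M ⊗ N') ⊗ P` of `k : N ⟶ N' ⊗ P` and an associator, in terms of tensor
products in `V`. -/
lemma whiskerL_assocIso_inv_ι₂ {A B C D : Comon V} {M : Bicomod A B} {N : Bicomod B D}
    {N' : Bicomod B C} {P : Bicomod C D} (k : N ⟶ tensor N' P) :
    (whiskerL M k ≫ (assocIso M N' P).inv).hom ≫ ι (tensor M N') P ≫ ι M N' ▷ P.X =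
      ι M N ≫ M.X ◁ (k.hom ≫ ι N' P) ≫ (α_ _ _ _).inv := by
  have h := assocIso_inv_ι M N' P
  rw [comp_hom, Category.assoc, h, whiskerL_ι_assoc]
  simp

end Bicomod

/-! ### The adjunction `f_* ⊣ f^*` and its comonad -/

namespace Comod

open Bicomod

variable {V : Type u} [Category.{v} V] [MonoidalCategory V] [BraidedCategory V]
  [HasCoreflexiveEqualizers V] [TensorPreservesCoreflexiveEqualizers V] {G E : Comon V}

section Adjunction

variable (f : G ⟶ E)

/-- The unit of the adjunction `f_* ⊣ f^*`, given by the comultiplication. -/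
noncomputable def starUnit : Hom (regular G) (tensor (lower f) (upper f)) :=
  homLift (T := regular G) (M := lower f) (N := upper f) Δ[G.X]
    (by
      change Δ[G.X] ≫ (Δ[G.X] ≫ G.X ◁ f.hom) ▷ G.X ≫ (α_ G.X E.X G.X).hom =
        Δ[G.X] ≫ G.X ◁ (Δ[G.X] ≫ f.hom ▷ G.X)
      simp)
    (by
      change Δ[G.X] ≫ Δ[G.X] ▷ G.X ≫ (α_ G.X G.X G.X).hom = Δ[G.X] ≫ G.X ◁ Δ[G.X]
      simp)
    (by
      change Δ[G.X] ≫ G.X ◁ Δ[G.X] ≫ (α_ G.X G.X G.X).inv = Δ[G.X] ≫ Δ[G.X] ▷ G.X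
      simp)

lemma starUnit_ι : (starUnit f).hom ≫ ι (lower f) (upper f) = Δ[G.X] :=
  lift_ι _ _

/-- The map `f` as a comodule map. -/
def corestrictHom : (upper f).corestrict f ⟶ regular E where
  hom := f.hom
  hom_coactL := by
    change f.hom ≫ Δ[E.X] = (Δ[G.X] ≫ f.hom ▷ G.X) ≫ E.X ◁ f.hom
    rw [comul_right, Category.assoc]
  hom_coactR := by
    change f.hom ≫ Δ[E.X] = (Δ[G.X] ≫ G.X ◁ f.hom) ≫ f.hom ▷ E.X
    rw [comul_left, Category.assoc]

/-- The counit of the adjunction `f_* ⊣ f^*`, given by `f` under `f^* ⊗_G f_* ≅ G`. -/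
noncomputable def starCounit : tensor (upper f) (lower f) ⟶ regular E :=
  (corestrictIso (upper f) f).inv ≫ corestrictHom f

/-- The inclusion `f^* ⊗_G f_* ⟶ G ⊗ G`, with a type that mentions only `G.X`. -/
noncomputable def upperLowerι : (tensor (upper f) (lower f)).X ⟶ G.X ⊗ G.X :=
  ι (upper f) (lower f)

/-- The isomorphism `f^* ⊗_G f_* ⟶ G`. -/
noncomputable def upperLowerHom : (tensor (upper f) (lower f)).X ⟶ G.X :=
  lowerCounit (upper f) f

@[simp]
lemma upperLowerHom_comul : upperLowerHom f ≫ Δ[G.X] = upperLowerι f :=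
  lowerCounit_coactR (upper f) f

@[simp]
lemma upperLowerHom_comul_assoc : type_of% (reassoc_of% @upperLowerHom_comul) :=
  @(reassoc_of% @upperLowerHom_comul)

lemma upperLowerHom_eq : upperLowerHom f = upperLowerι f ≫ ε[G.X] ▷ G.X ≫ (λ_ G.X).hom := by
  rw [← upperLowerHom_comul_assoc, counit_comul_assoc, Iso.inv_hom_id, Category.comp_id]

lemma starCounit_hom : (starCounit f).hom = upperLowerHom f ≫ f.hom := rfl

lemma starCounit_eq :
    (starCounit f).hom = ι (upper f) (lower f) ≫ ε[G.X] ▷ G.X ≫ (λ_ G.X).hom ≫ f.hom := by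
  refine (starCounit_hom f).trans ?_
  rw [upperLowerHom_eq, Category.assoc, Category.assoc]
  rfl

/-- A triangle identity for `f_* ⊣ f^*`. After the inclusion in `G ⊗ E`, both sides are
`(1 ⊗ f) Δ`, by coassociativity and a counit law. -/
lemma star_left_triangle :
    (leftUnitorIso (lower f)).inv ≫ whiskerR (starUnit f) (lower f) ≫
      (assocIso (lower f) (upper f) (lower f)).hom ≫ whiskerL (lower f) (starCounit f) =
    (rightUnitorIso (lower f)).inv := by
  apply tensor_hom_ext
  have h₁ : (leftUnitorIso (lower f)).inv.hom ≫ ι _ _ = (lower f).coactL := lift_ι _ _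
  have h₂ : (rightUnitorIso (lower f)).inv.hom ≫ ι _ _ = (lower f).coactR := lift_ι _ _
  have h₃ : (starUnit f).hom ▷ (lower f).X ≫ ι (lower f) (upper f) ▷ (lower f).X =
      Δ[G.X] ▷ G.X := by
    rw [← comp_whiskerRight, starUnit_ι]
    rfl
  rw [h₂]
  simp only [comp_hom, Category.assoc, whiskerL_ι, starCounit_eq]
  rw [whiskerLeft_comp, assocIso_hom_ι_assoc, whiskerR_ι_assoc, reassoc_of% h₁, reassoc_of% h₃]
  change Δ[G.X] ≫ Δ[G.X] ▷ G.X ≫ (α_ G.X G.X G.X).hom ≫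
    G.X ◁ (ε[G.X] ▷ G.X ≫ (λ_ G.X).hom ≫ f.hom) = Δ[G.X] ≫ G.X ◁ f.hom
  rw [← ComonObj.comul_assoc_assoc, ← whiskerLeft_comp, counit_comul_assoc, Iso.inv_hom_id_assoc]

/-- The other triangle identity: after the inclusion in `E ⊗ G`, both sides are `(f ⊗ 1) Δ`. -/
lemma star_right_triangle :
    (rightUnitorIso (upper f)).inv ≫ whiskerL (upper f) (starUnit f) ≫
      (assocIso (upper f) (lower f) (upper f)).inv ≫ whiskerR (starCounit f) (upper f) =
    (leftUnitorIso (upper f)).inv := by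
  apply tensor_hom_ext
  have h₁ : (leftUnitorIso (upper f)).inv.hom ≫ ι _ _ = (upper f).coactL := lift_ι _ _
  have h₂ : (rightUnitorIso (upper f)).inv.hom ≫ ι _ _ = (upper f).coactR := lift_ι _ _
  have h₃ : (upper f).X ◁ (starUnit f).hom ≫ (upper f).X ◁ ι (lower f) (upper f) =
      G.X ◁ Δ[G.X] := by
    rw [← whiskerLeft_comp, starUnit_ι]
    rfl
  have h₄ := assocIso_inv_ι (upper f) (lower f) (upper f)
  rw [h₁]
  simp only [comp_hom, Category.assoc, whiskerR_ι, starCounit_eq]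
  rw [comp_whiskerRight, reassoc_of% h₄, whiskerL_ι_assoc, reassoc_of% h₂, reassoc_of% h₃]
  change Δ[G.X] ≫ G.X ◁ Δ[G.X] ≫ (α_ G.X G.X G.X).inv ≫
    (ε[G.X] ▷ G.X ≫ (λ_ G.X).hom ≫ f.hom) ▷ G.X = Δ[G.X] ≫ f.hom ▷ G.X
  rw [← ComonObj.comul_assoc_flip_assoc, ← comp_whiskerRight, counit_comul_assoc,
    Iso.inv_hom_id_assoc]

/-- The adjunction `f_* ⊣ f^*`. -/
noncomputable def starAdjunction : Bicategory.Adjunction (star f) (costar f) where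
  unit := starUnit f
  counit := starCounit f
  left_triangle := by
    rw [← Iso.inv_comp_eq]
    refine Eq.trans ?_ (star_left_triangle f)
    simp [Bicategory.leftZigzag, bicategoricalComp]
    rfl
  right_triangle := by
    rw [← Iso.inv_comp_eq]
    refine Eq.trans ?_ (star_right_triangle f)
    simp [Bicategory.rightZigzag, bicategoricalComp]
    rfl

/-- The map `f_* ⟶ f_* ⊗_G f^* ⊗_E f_*` followed by the inclusion in `G ⊗ G ⊗ G` is the iterated
comultiplication. -/
lemma starUnit_lower :
    ((leftUnitorIso (lower f)).inv ≫ whiskerR (starUnit f) (lower f) ≫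
      (assocIso (lower f) (upper f) (lower f)).hom).hom ≫
        ι (lower f) (tensor (upper f) (lower f)) ≫ (lower f).X ◁ ι (upper f) (lower f) =
    Δ[G.X] ≫ G.X ◁ Δ[G.X] := by
  have h₁ : (leftUnitorIso (lower f)).inv.hom ≫ ι _ _ = (lower f).coactL := lift_ι _ _
  have h₃ : (starUnit f).hom ▷ (lower f).X ≫ ι (lower f) (upper f) ▷ (lower f).X =
      Δ[G.X] ▷ G.X := by
    rw [← comp_whiskerRight, starUnit_ι]
    rfl
  simp only [comp_hom, Category.assoc]
  rw [assocIso_hom_ι, whiskerR_ι_assoc, reassoc_of% h₁, reassoc_of% h₃]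
  exact (ComonObj.comul_assoc G.X).symm

/-- The comultiplication of the comonad induced by `f_* ⊣ f^*`. -/
noncomputable def inducedComul :
    tensor (upper f) (lower f) ⟶ tensor (tensor (upper f) (lower f)) (tensor (upper f) (lower f)) :=
  whiskerL (upper f) ((leftUnitorIso (lower f)).inv ≫ whiskerR (starUnit f) (lower f) ≫
      (assocIso (lower f) (upper f) (lower f)).hom) ≫ (assocIso _ _ _).inv

lemma inducedComul_ι :
    ((inducedComul f).hom ≫ ι _ _) ≫ (upperLowerι f ⊗ₘ upperLowerι f) =
      upperLowerι f ≫ G.X ◁ (Δ[G.X] ≫ G.X ◁ Δ[G.X]) ≫ (α_ _ _ _).inv := by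
  rw [← starUnit_lower f, MonoidalCategory.tensorHom_def, Category.assoc]
  exact whiskerL_assocIso_inv_ι _

/-- Under `f^* ⊗_G f_* ≅ G`, the comultiplication of the induced comonad is that of `G`. -/
lemma inducedComul_upperLowerHom :
    ((inducedComul f).hom ≫ ι _ _) ≫ (upperLowerHom f ⊗ₘ upperLowerHom f) =
      upperLowerHom f ≫ Δ[G.X] := by
  have h : (upperLowerHom f ⊗ₘ upperLowerHom f) = (upperLowerι f ⊗ₘ upperLowerι f) ≫
      (G.X ⊗ G.X) ◁ (ε[G.X] ▷ G.X ≫ (λ_ G.X).hom) ≫ (ε[G.X] ▷ G.X ≫ (λ_ G.X).hom) ▷ G.X := by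
    rw [← MonoidalCategory.tensorHom_def', tensorHom_comp_tensorHom, ← upperLowerHom_eq]
  rw [h, ← Category.assoc]
  refine (congrArg (· ≫ _) (inducedComul_ι f)).trans ?_
  simp only [Category.assoc]
  rw [← associator_inv_naturality_right_assoc, ← whiskerLeft_comp_assoc,
    Category.assoc, ← whiskerLeft_comp, counit_comul_assoc, Iso.inv_hom_id, whiskerLeft_id,
    Category.comp_id, ← upperLowerHom_comul_assoc, ← ComonObj.comul_assoc_flip_assoc,
    ← comp_whiskerRight, counit_comul_assoc, Iso.inv_hom_id, id_whiskerRight, Category.comp_id]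

/-- The comonad induced by `f_* ⊣ f^*` corresponds to `f`. -/
noncomputable def inducedComonadIso :
    (comonadToOver E).obj (Bicategory.inducedComonad (starAdjunction f)) ≅ Over.mk f :=
  Over.isoMk (Comon.mkIso (N := G)
    { hom := upperLowerHom f
      inv := lowerCoact (upper f) f
      hom_inv_id := lowerCounit_lowerCoact (upper f) f
      inv_hom_id := lowerCoact_lowerCounit (upper f) f }
    (by
      change upperLowerHom f ≫ ε[G.X] = ((starCounit f).hom ≫ ε[E.X])
      rw [starCounit_hom, Category.assoc]
      exact congrArg _ (IsComonHom.hom_counit f.hom).symm)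
    (by
      refine (inducedComul_upperLowerHom f).symm.trans ?_
      change _ = totalComul (Bicategory.inducedComonad (starAdjunction f)).X ≫ _
      refine congrArg (fun k => (Hom.hom k ≫ ι _ _) ≫ (upperLowerHom f ⊗ₘ upperLowerHom f)) ?_
      simp [inducedComul, whiskerL_comp]
      rfl)) (by ext; rfl)

end Adjunction

/-! ### Comonads on `E` and comonoids over `E` -/

section Over

lemma faithful_comonadToOver : (comonadToOver E).Faithful where
  map_injective {G H} g h e := by
    ext
    exact hom_ext (congrArg (fun k => k.left.hom) e)

section

variable {X : Comod V} {t t' : X ⟶ X} [Bicategory.Comonad t] [Bicategory.Comonad t']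
  (k : (bicomod t).X ⟶ (bicomod t').X) (hε : k ≫ totalMap t' = totalMap t)
  (hδ : k ≫ totalComul t' = totalComul t ≫ (k ⊗ₘ k))

/-- The coactions of a comonad are determined by its comultiplication and counit in `V`, so a map
compatible with the latter is a 2-cell. -/
def homOfTotal : t ⟶ t' :=
  Hom.mk k
    (by
      rw [← totalComul_totalMap_left, ← totalComul_totalMap_left, reassoc_of% hδ,
        MonoidalCategory.tensorHom_def', Category.assoc, Category.assoc, ← comp_whiskerRight, hε,
        whisker_exchange])
    (by
      rw [← totalComul_totalMap_right, ← totalComul_totalMap_right, reassoc_of% hδ,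
        MonoidalCategory.tensorHom_def, Category.assoc, Category.assoc, ← whiskerLeft_comp, hε,
        ← whisker_exchange])

lemma isComonHom_homOfTotal : IsComonHom (homOfTotal k hε hδ) where
  hom_counit := map_ext hε
  hom_comul := by
    apply tensor_hom_ext
    refine Eq.trans ((Category.assoc _ _ _).trans hδ) ?_
    rw [MonoidalCategory.tensorHom_def, MonoidalCategory.tensorHom_def]
    have h₁ := map_whiskerRight (homOfTotal k hε hδ) t
    have h₂ := map_whiskerLeft t' (homOfTotal k hε hδ)
    change (map Bicategory.Comonad.comul ≫ ι (bicomod t) (bicomod t)) ≫ k ▷ _ ≫ _ ◁ k =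
      (map Bicategory.Comonad.comul ≫ map (Bicategory.whiskerRight (homOfTotal k hε hδ) t) ≫
        map (Bicategory.whiskerLeft t' (homOfTotal k hε hδ))) ≫ ι (bicomod t') (bicomod t')
    simp only [Category.assoc, h₂, reassoc_of% h₁]
    rfl

end

lemma full_comonadToOver : (comonadToOver E).Full where
  map_surjective {G H} h :=
    have := isComonHom_homOfTotal (t := G.X) (t' := H.X) h.left.hom
      (congrArg Comon.Hom.hom (Over.w h)) (IsComonHom.hom_comul h.left.hom)
    ⟨.mk (homOfTotal (t := G.X) (t' := H.X) h.left.hom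
      (congrArg Comon.Hom.hom (Over.w h)) (IsComonHom.hom_comul h.left.hom)), by ext; rfl⟩

/-- Comonads on `E` are equivalent to comonoids over `E`. -/
lemma isEquivalence_comonadToOver : (comonadToOver E).IsEquivalence where
  faithful := faithful_comonadToOver
  full := full_comonadToOver
  essSurj := ⟨fun Y => ⟨_, ⟨inducedComonadIso Y.hom⟩⟩⟩

end Over

end Comod

/-! ### Coalgebras for a comonad as comonad maps -/

namespace Bicategory

universe w₁ v₁ u₁

-- The names for whiskerings, associators and unitors also denote those of a monoidal category.
local infixr:81 (priority := high) " ◁ " => Bicategory.whiskerLeft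
local infixl:81 (priority := high) " ▷ " => Bicategory.whiskerRight
local infixr:80 (priority := high) " ⊗≫ " => bicategoricalComp
local notation (priority := high) "α_" => Bicategory.associator
local notation (priority := high) "λ_" => Bicategory.leftUnitor
local notation (priority := high) "ρ_" => Bicategory.rightUnitor

open OplaxTrans OplaxTrans.ComonadBicat

namespace CoalgebraHom

variable {B : Type u₁} [Bicategory.{w₁, v₁} B] {y a : B} {t : a ⟶ a} [Comonad t]

/-- The 1-cell underlying a coalgebra for `t`. -/
def carrier (N : (comonadInclusion B).obj y ⟶ mkOfComonad t) : y ⟶ a :=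
  Oplax.OplaxTrans.app N ⟨⟨⟨⟩⟩⟩

/-- The 2-cell of a coalgebra for `t`, regarded as a comonad map from an identity comonad. -/
def structureHom (N : (comonadInclusion B).obj y ⟶ mkOfComonad t) :
    𝟙 y ≫ carrier N ⟶ carrier N ≫ t :=
  Oplax.OplaxTrans.naturality N (𝟙 (⟨⟨⟨⟩⟩⟩ : LocallyDiscrete (Discrete Unit)))

/-- The coaction of a coalgebra for `t`. -/
def coaction (N : (comonadInclusion B).obj y ⟶ mkOfComonad t) : carrier N ⟶ carrier N ≫ t :=
  (λ_ (carrier N)).inv ≫ structureHom N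

lemma structureHom_eq (N : (comonadInclusion B).obj y ⟶ mkOfComonad t) :
    structureHom N = (λ_ (carrier N)).hom ≫ coaction N := by
  rw [coaction, Iso.hom_inv_id_assoc]

lemma coaction_counit (N : (comonadInclusion B).obj y ⟶ mkOfComonad t) :
    coaction N ≫ carrier N ◁ Comonad.counit = (ρ_ (carrier N)).inv := by
  have h := Oplax.OplaxTrans.naturality_id N ⟨⟨⟨⟩⟩⟩
  change structureHom N ≫ carrier N ◁ Comonad.counit =
    𝟙 (𝟙 y) ▷ carrier N ≫ (λ_ (carrier N)).hom ≫ (ρ_ (carrier N)).inv at h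
  simpa [structureHom_eq] using h

lemma coaction_comul (N : (comonadInclusion B).obj y ⟶ mkOfComonad t) :
    coaction N ≫ carrier N ◁ Comonad.comul =
      coaction N ≫ coaction N ▷ t ≫ (α_ (carrier N) t t).hom := by
  have h := Oplax.OplaxTrans.naturality_comp N
    (𝟙 (⟨⟨⟨⟩⟩⟩ : LocallyDiscrete (Discrete Unit))) (𝟙 (⟨⟨⟨⟩⟩⟩ : LocallyDiscrete (Discrete Unit)))
  change structureHom N ≫ carrier N ◁ Comonad.comul (t := t) =
    (λ_ (𝟙 y)).inv ▷ carrier N ≫ (α_ (𝟙 y) (𝟙 y) (carrier N)).hom ≫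
      𝟙 y ◁ structureHom N ≫ (α_ (𝟙 y) (carrier N) t).inv ≫
      structureHom N ▷ t ≫ (α_ (carrier N) t t).hom at h
  rw [structureHom_eq, Category.assoc] at h
  rw [← cancel_epi (λ_ (carrier N)).hom, h]
  calc _ = 𝟙 y ◁ coaction N ≫ (λ_ (carrier N ≫ t)).hom ≫ coaction N ▷ t ≫
        (α_ (carrier N) t t).hom := by bicategory
    _ = _ := by rw [leftUnitor_naturality_assoc]

variable {N N' : (comonadInclusion B).obj y ⟶ mkOfComonad t}

/-- The 2-cell underlying a map of coalgebras. -/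
def hom (φ : N ⟶ N') : carrier N ⟶ carrier N' := φ.as.app ⟨⟨⟨⟩⟩⟩

lemma hom_ext {φ ψ : N ⟶ N'} (h : hom φ = hom ψ) : φ = ψ :=
  Oplax.OplaxTrans.homCategory.ext fun _ => h

lemma hom_coaction (φ : N ⟶ N') : hom φ ≫ coaction N' = coaction N ≫ hom φ ▷ t := by
  have h := φ.as.naturality (𝟙 (⟨⟨⟨⟩⟩⟩ : LocallyDiscrete (Discrete Unit)))
  change 𝟙 y ◁ hom φ ≫ structureHom N' = structureHom N ≫ hom φ ▷ t at h
  rw [structureHom_eq, structureHom_eq, leftUnitor_naturality_assoc, Category.assoc] at h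
  exact (cancel_epi _).1 h

/-- A map of coalgebras from a 2-cell which commutes with the coactions. -/
def mk (τ : carrier N ⟶ carrier N') (h : τ ≫ coaction N' = coaction N ≫ τ ▷ t) : N ⟶ N' :=
  comonadMap₂ τ (by
    change 𝟙 y ◁ τ ≫ structureHom N' = structureHom N ≫ τ ▷ t
    rw [structureHom_eq, structureHom_eq, leftUnitor_naturality_assoc, h, Category.assoc])

/-- An isomorphism of coalgebras from an invertible 2-cell which commutes with the coactions. -/
def isoMk (τ : carrier N ≅ carrier N')
    (h : τ.hom ≫ coaction N' = coaction N ≫ τ.hom ▷ t) : N ≅ N' where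
  hom := mk τ.hom h
  inv := mk τ.inv (by
    rw [Iso.inv_comp_eq, reassoc_of% h, ← comp_whiskerRight, Iso.hom_inv_id, id_whiskerRight,
      Category.comp_id])
  hom_inv_id := hom_ext τ.hom_inv_id
  inv_hom_id := hom_ext τ.inv_hom_id

/-- The composite of a coalgebra `(k, γ)` with a 1-cell `M` has coaction `M ◁ γ`. -/
lemma coaction_postcompAfter {x : B} (U : (comonadInclusion B).obj x ⟶ mkOfComonad t)
    (M : y ⟶ x) :
    coaction ((postcompAfter (comonadInclusion B) y U).obj M) =
      M ◁ coaction U ≫ (α_ M (carrier U) t).inv := by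
  change (λ_ (M ≫ carrier U)).inv ≫ (α_ (𝟙 y) M (carrier U)).inv ≫
    ((λ_ M).hom ≫ (ρ_ M).inv) ▷ carrier U ≫ (α_ M (𝟙 x) (carrier U)).hom ≫
      M ◁ structureHom U ≫ (α_ M (carrier U) t).inv = _
  rw [structureHom_eq]
  bicategory

lemma coaction_coalgebra (k : y ⟶ a) (γ : k ⟶ k ≫ t)
    (h_counit : γ ≫ k ◁ Comonad.counit = (ρ_ k).inv)
    (h_comul : γ ≫ k ◁ Comonad.comul = γ ≫ γ ▷ t ≫ (α_ k t t).hom) :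
    coaction (coalgebra k γ h_counit h_comul) = γ :=
  (λ_ k).inv_hom_id_assoc γ

end CoalgebraHom

/-- An oplax functor from the trivial bicategory is determined by its comonad. -/
lemma toOplax_ofOplaxFromUnit {B : Type u₁} [Bicategory.{w₁, v₁} B]
    (F : LocallyDiscrete (Discrete Unit) ⥤ᵒᵖᴸ B) :
    F = @Comonad.toOplax B _ _ _ (Comonad.ofOplaxFromUnit F) := by
  -- The 0-, 1- and 2-cells of the trivial bicategory are definitionally the identities, so only the
  -- action on 2-cells and `mapComp` may differ: `map₂_id` determines the former, and the latter is
  -- composed with an identity on the right-hand side, whence `hc`.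
  obtain ⟨⟨⟨⟨o, m⟩, m₂⟩, h₁, h₂⟩, i, c, n₁, n₂, a, l, r⟩ := F
  have hm₂ : @m₂ = fun {_ _ _ _} _ => 𝟙 (m (𝟙 (⟨⟨⟨⟩⟩⟩ : LocallyDiscrete (Discrete Unit)))) := by
    funext _ _ _ _ _
    exact h₁ (𝟙 (⟨⟨⟨⟩⟩⟩ : LocallyDiscrete (Discrete Unit)))
  subst hm₂
  have hc : @c = fun {_ _ _} _ _ => 𝟙 _ ≫ c
      (𝟙 (⟨⟨⟨⟩⟩⟩ : LocallyDiscrete (Discrete Unit))) (𝟙 (⟨⟨⟨⟩⟩⟩ : LocallyDiscrete (Discrete Unit))) := by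
    funext _ _ _ _ _
    exact (Category.id_comp _).symm
  dsimp only [Comonad.toOplax, Comonad.comul, Comonad.ofOplaxFromUnit]
  congr 1

lemma exists_eq_mkOfComonad {B : Type u₁} [Bicategory.{w₁, v₁} B] (m : ComonadBicat B) :
    ∃ (a : B) (t : a ⟶ a) (_ : Comonad t), m = mkOfComonad t :=
  ⟨m.obj, m.hom, inferInstance, toOplax_ofOplaxFromUnit m⟩

end Bicategory

/-! ### The universal coalgebra -/

namespace Comod

open Bicomod Bicategory.OplaxTrans.ComonadBicat Bicategory.CoalgebraHom

variable {V : Type u} [Category.{v} V] [MonoidalCategory V] [BraidedCategory V]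
  [HasCoreflexiveEqualizers V] [TensorPreservesCoreflexiveEqualizers V] {y E : Comod V}
  {t : E ⟶ E} [Bicategory.Comonad t]

section

variable (N : (Bicategory.comonadInclusion (Comod V)).obj y ⟶ mkOfComonad t)

/-- The coaction `k ⟶ k ⊗_E G ⟶ k ⊗ G` in `V` of a coalgebra `k` for a comonad `G` on `E`. -/
noncomputable def totalCoact : (bicomod (carrier N)).X ⟶ (bicomod (carrier N)).X ⊗ (bicomod t).X :=
  map (coaction N) ≫ ι (bicomod (carrier N)) (bicomod t)

/-- The right `E`-coaction of a coalgebra is recovered from its `G`-coaction, by the counit law. -/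
lemma totalCoact_totalMap :
    totalCoact N ≫ (bicomod (carrier N)).X ◁ totalMap t = (bicomod (carrier N)).coactR := by
  have h := congrArg map (Bicategory.CoalgebraHom.coaction_counit N)
  rw [← map_rightUnitor_inv, ← h, map_comp, totalCoact, Category.assoc, Category.assoc]
  exact congrArg _ (map_whiskerLeft (carrier N) (Bicategory.Comonad.counit (t := t))).symm

lemma totalCoact_totalComul :
    totalCoact N ≫ (bicomod (carrier N)).X ◁ totalComul t =
      totalCoact N ≫ totalCoact N ▷ (bicomod t).X ≫ (α_ _ _ _).hom := by
  have h := congrArg (fun x => map x ≫ ι (bicomod (carrier N)) (bicomod (t ≫ t)) ≫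
    (bicomod (carrier N)).X ◁ ι (bicomod t) (bicomod t)) (Bicategory.CoalgebraHom.coaction_comul N)
  simp only [map_comp, Category.assoc, map_associator, map_whiskerLeft_assoc] at h
  rw [map_whiskerRight_assoc] at h
  simp only [totalCoact, totalComul, Category.assoc, whiskerLeft_comp, comp_whiskerRight]
  exact h

lemma coactL_totalCoact :
    (bicomod (carrier N)).coactL ≫ y.comon.X ◁ totalCoact N =
      totalCoact N ≫ (bicomod (carrier N)).coactL ▷ (bicomod t).X ≫ (α_ _ _ _).hom := by
  have h := (coaction N).hom_coactL
  have h' := coactL_ι (bicomod (carrier N)) (bicomod t)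
  simp only [totalCoact, Category.assoc, whiskerLeft_comp, ← h']
  exact ((Category.assoc _ _ _).symm.trans
    ((congrArg (· ≫ y.comon.X ◁ ι (bicomod (carrier N)) (bicomod t)) h).symm.trans
      (Category.assoc _ _ _)))

/-- A coalgebra for a comonad `G` on `E` is a comodule to the comonoid `G`. -/
@[simps]
noncomputable def ofCoalgebra : Bicomod y.comon (total t) where
  X := (bicomod (carrier N)).X
  coactL := (bicomod (carrier N)).coactL
  coactR := totalCoact N
  coactL_counit := (bicomod (carrier N)).coactL_counit
  coactL_coassoc := (bicomod (carrier N)).coactL_coassoc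
  coactR_counit := by
    change totalCoact N ≫ _ ◁ (totalMap t ≫ ε[E.comon.X]) = _
    rw [whiskerLeft_comp, ← Category.assoc, totalCoact_totalMap, coactR_counit]
  coactR_coassoc := by
    change totalCoact N ≫ totalCoact N ▷ (bicomod t).X =
      totalCoact N ≫ (bicomod (carrier N)).X ◁ totalComul t ≫
        (α_ (bicomod (carrier N)).X (bicomod t).X (bicomod t).X).inv
    rw [← Category.assoc (totalCoact N), totalCoact_totalComul]
    simp
  coact_comm := coactL_totalCoact N

end

variable {N N' : (Bicategory.comonadInclusion (Comod V)).obj y ⟶ mkOfComonad t}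

lemma hom_totalCoact (φ : N ⟶ N') :
    map (hom φ) ≫ totalCoact N' = totalCoact N ≫ map (hom φ) ▷ (bicomod t).X := by
  have h := congrArg map (hom_coaction φ)
  simp only [map_comp] at h
  rw [totalCoact, totalCoact, ← Category.assoc, h, Category.assoc, Category.assoc]
  exact congrArg _ (map_whiskerRight _ _)

/-- Compatibility of a 2-cell with the coactions of coalgebras may be checked in `V`. -/
lemma comp_coaction_of_totalCoact (τ : carrier N ⟶ carrier N')
    (h : map τ ≫ totalCoact N' = totalCoact N ≫ map τ ▷ (bicomod t).X) :
    τ ≫ coaction N' = coaction N ≫ Bicategory.whiskerRight τ t := by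
  apply tensor_hom_ext
  refine (Category.assoc _ _ _).trans (h.trans ?_)
  rw [totalCoact, Category.assoc]
  exact ((Category.assoc _ _ _).trans (congrArg _ (map_whiskerRight τ t))).symm

variable (t y) in
/-- Composition with the coalgebra `(ε_*, δ)`. -/
noncomputable abbrev compUniversal :=
  Bicategory.postcompAfter (Bicategory.comonadInclusion (Comod V)) y (universalCoalgebra t)

/-- Composition with `(ε_*, δ)` sends `M` to `M ⊗_G ε_*` with the coaction of the comonoid `G`. -/
lemma totalCoact_compUniversal (M : y ⟶ ⟨total t⟩) :
    totalCoact ((compUniversal y t).obj M) = lowerTotalCoact (bicomod M) (totalHom t) := by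
  have h : coaction (universalCoalgebra t) = universalCoaction t := coaction_coalgebra _ _ _ _
  -- The coaction of the composite is `M ⊗ δ` followed by an associator.
  have e : totalCoact ((compUniversal y t).obj M) =
      (whiskerL (bicomod M) (universalCoaction t) ≫
        (assocIso (bicomod M) (lower (totalHom t)) (bicomod t)).inv).hom ≫ ι _ _ :=
    congrArg (fun k => map k ≫ ι _ _) ((coaction_postcompAfter (universalCoalgebra t) M).trans
      (congrArg (fun γ => Bicategory.whiskerLeft M γ ≫ _) h))
  refine (cancel_mono (lowerι (bicomod M) (totalHom t) ▷ (total t).X)).1 ?_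
  refine Eq.trans ?_ (lowerTotalCoact_ι _ _).symm
  refine (congrArg (· ≫ _) e).trans ((Category.assoc _ _ _).trans
    ((whiskerL_assocIso_inv_ι₂ (universalCoaction t)).trans ?_))
  exact congrArg (fun k => _ ≫ (bicomod M).X ◁ k ≫ _) (universalCoaction_ι t)

lemma full_compUniversal : (compUniversal y t).Full where
  map_surjective {M M'} φ := by
    have h := hom_totalCoact φ
    rw [totalCoact_compUniversal, totalCoact_compUniversal] at h
    obtain ⟨g, hg⟩ := exists_whiskerR_lower_eq _ _ h
    exact ⟨g, Bicategory.CoalgebraHom.hom_ext hg⟩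

lemma faithful_compUniversal : (compUniversal y t).Faithful where
  map_injective h := whiskerR_lower_injective (totalHom t) (congrArg hom h)

/-- The comodule constructed from a coalgebra recovers the coalgebra. -/
noncomputable def compUniversalOfCoalgebraIso
    (N : (Bicategory.comonadInclusion (Comod V)).obj y ⟶ mkOfComonad t) :
    (compUniversal y t).obj (ofCoalgebra N) ≅ N := by
  let i : (ofCoalgebra N).corestrict (totalHom t) ≅ bicomod (carrier N) :=
    Bicomod.isoMk
      { hom := 𝟙 (bicomod (carrier N)).X
        hom_coactL := (Category.id_comp _).trans
          ((Category.comp_id _).symm.trans (congrArg _ (whiskerLeft_id _ _).symm))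
        hom_coactR := (Category.id_comp _).trans ((totalCoact_totalMap N).symm.trans
          ((Category.comp_id _).symm.trans (congrArg _ (id_whiskerRight _ _).symm))) }
      (𝟙 (bicomod (carrier N)).X) (Category.id_comp _) (Category.id_comp _)
  refine Bicategory.CoalgebraHom.isoMk
    ((corestrictIso (ofCoalgebra N) (totalHom t)).symm ≪≫ i)
    (comp_coaction_of_totalCoact _ ?_)
  rw [totalCoact_compUniversal]
  have e : map ((corestrictIso (ofCoalgebra N) (totalHom t)).symm ≪≫ i).hom =
      lowerCounit (ofCoalgebra N) (totalHom t) := Category.comp_id _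
  refine (congrArg (· ≫ totalCoact N) e).trans ?_
  refine Eq.trans ?_ (congrArg (fun k => _ ≫ k ▷ (total t).X) e).symm
  exact (lowerTotalCoact_lowerCounit (ofCoalgebra N) (totalHom t)).symm

lemma essSurj_compUniversal : (compUniversal y t).EssSurj where
  mem_essImage N := ⟨_, ⟨compUniversalOfCoalgebraIso N⟩⟩

/-- The comonoid `G` with the coalgebra `(ε_*, δ)` is an Eilenberg–Moore object of `(E, G)`. -/
lemma isUniversalCoalgebra (E : Comod V) (t : E ⟶ E) [Bicategory.Comonad t] :
    Bicategory.IsUniversalCoalgebra (universalCoalgebra t) := fun _ =>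
  { full := full_compUniversal
    faithful := faithful_compUniversal
    essSurj := essSurj_compUniversal }

theorem admitsEilenbergMoore : Bicategory.AdmitsEilenbergMoore (Comod V) := by
  have h (m : Bicategory.OplaxTrans.ComonadBicat (Comod V)) :
      ∃ (x : Comod V) (u : (Bicategory.comonadInclusion (Comod V)).obj x ⟶ m),
        Bicategory.IsUniversalCoalgebra u := by
    obtain ⟨E, t, _, rfl⟩ := Bicategory.exists_eq_mkOfComonad m
    exact ⟨_, _, isUniversalCoalgebra E t⟩
  choose R u hu using h
  have _ := fun x m => hu m x
  exact ⟨Bicategory.UniversalArrows.rightBiadjoint (Bicategory.comonadInclusion (Comod V)) u⟩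

end Comod
end CategoryTheory

theorem proposition6 {V : Type u} [Category.{v} V] [MonoidalCategory V] [BraidedCategory V]
    [HasCoreflexiveEqualizers V] [TensorPreservesCoreflexiveEqualizers V] :
    -- the inclusion of `Comod V` in the bicategory of comonads in it has a right biadjoint
    Bicategory.AdmitsEilenbergMoore (Comod V) ∧
    ∀ E : Comon V,
      -- comonads on `E` are equivalent to comonoid maps with codomain `E`
      (Comod.comonadToOver E).IsEquivalence ∧
      -- the comonad corresponding to a comonoid map `f` is induced by the adjunction `f_* ⊣ f^*`
      (∀ (G : Comon V) (f : G ⟶ E),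
        ∃ adj : Bicategory.Adjunction (Comod.star f) (Comod.costar f),
          Comod.map adj.unit ≫ Bicomod.ι (Comod.lower f) (Comod.upper f) = Δ[G.X] ∧
          Comod.map adj.counit =
            Bicomod.ι (Comod.upper f) (Comod.lower f) ≫ ε[G.X] ▷ G.X ≫ (λ_ G.X).hom ≫ f.hom ∧
          Nonempty ((Comod.comonadToOver E).obj (Bicategory.inducedComonad adj) ≅ Over.mk f)) ∧
      -- for a comonad `G` on `E`, the comonoid `G` with the coalgebra `(ε_*, δ)` is an
      -- Eilenberg–Moore object of `(E, G)`
      ∀ (G : (⟨E⟩ : Comod V) ⟶ ⟨E⟩) [Bicategory.Comonad G],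
        Bicategory.IsUniversalCoalgebra (Comod.universalCoalgebra G) := by
  exact ⟨Comod.admitsEilenbergMoore, fun E => ⟨Comod.isEquivalence_comonadToOver, fun G f =>
    ⟨Comod.starAdjunction f, Comod.starUnit_ι f, Comod.starCounit_eq f, ⟨Comod.inducedComonadIso f⟩⟩,
    fun G _ => Comod.isUniversalCoalgebra _ G⟩⟩
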